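/- Let $(R_0,\mathfrak m_0,k)$ be a regular local ring and let $R=\bigoplus_{\mu\ge 0}R_\mu$ be a Noetherian standard graded $R_0$-algebra, i.e. the degree zero component of $R$ is $R_0$ and $R=R_0[R_1]$. Let $R_+=\bigoplus_{\mu>0}R_\mu$. For finitely generated $\mathbb Z$-graded $R$-modules $M,N$ let $$H^i_{R_+}(M,N)=\varinjlim_n \operatorname{Ext}^i_R(M/R_+^nM,N)$$ be the generalized local cohomology modules with their natural $\mathbb Z$-grading, and put $$\operatorname{reg}_R(M,N)=\sup_{i\ge 0}\{\operatorname{end}(H^i_{R_+}(M,N))+i\}\in\mathbb Z\cup\{\pm\infty\},$$ where $\operatorname{end}(Q)$ denotes the supremum of the degrees of the nonzero homogeneous elements of a graded module $Q$ (with $\operatorname{end}(0)=-\infty$). Then the following are equivalent: (i) $\mathfrak m_0$ contains an $R$-regular sequence of length $\dim R_0$; (ii) $R_\mu$ is a free $R_0$-module for every $\mu$. If (i) holds, then $\operatorname{reg}_R(k,k)=\dim R_0$, where $k=R/(\mathfrak m_0R+R_+)$ is regarded as a graded $R$-module concentrated in degree $0$. -/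

import Mathlib

universe u

noncomputable section

open CategoryTheory CategoryTheory.Limits

variable {R₀ R : Type u} [CommRing R₀] [CommRing R] [Algebra R₀ R]

/-- `R` is a standard graded `R₀`-algebra: the degree zero component is (a copy of) `R₀`, and
`R = R₀[R₁]` is generated over it by the elements of degree one. -/
structure IsStandardGraded (𝒜 : ℕ → Submodule R₀ R) [GradedAlgebra 𝒜] : Prop where
  degree_zero : ∀ a ∈ 𝒜 0, ∃! r : R₀, algebraMap R₀ R r = a
  generated : Algebra.adjoin R₀ (𝒜 1 : Set R) = ⊤

/-- A `ℤ`-graded module `M = ⨁ Mⱼ` over the graded ring `R = ⨁ Rᵢ`. -/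
structure GrMod (𝒜 : ℕ → Submodule R₀ R) : Type (u + 1) where
  carrier : Type u
  [addCommGroup : AddCommGroup carrier]
  [module : Module R carrier]
  piece : ℤ → AddSubgroup carrier
  isInternal : DirectSum.IsInternal piece
  smul_mem : ∀ {i : ℕ} {j : ℤ} {a : R} {x : carrier}, a ∈ 𝒜 i → x ∈ piece j →
    a • x ∈ piece (i + j)

namespace GrMod

attribute [instance] GrMod.addCommGroup GrMod.module

variable {𝒜 : ℕ → Submodule R₀ R}

/-- The projection of a graded module to its component of degree `j`. -/
def proj (M : GrMod 𝒜) (j : ℤ) : M.carrier →+ M.carrier :=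
  let _ := M.isInternal.chooseDecomposition
  (M.piece j).subtype.comp
    ((DFinsupp.evalAddMonoidHom j).comp (DirectSum.decomposeAddEquiv M.piece).toAddMonoidHom)

lemma proj_mem (M : GrMod 𝒜) (j : ℤ) (x : M.carrier) : M.proj j x ∈ M.piece j :=
  SetLike.coe_mem _

lemma proj_of_mem (M : GrMod 𝒜) {j : ℤ} {x : M.carrier} (hx : x ∈ M.piece j) (i : ℤ) :
    M.proj i x = if j = i then x else 0 := by
  let _ := M.isInternal.chooseDecomposition
  change ((DirectSum.decompose M.piece x i : M.piece i) : M.carrier) = _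
  split_ifs with h
  · subst h
    exact DirectSum.decompose_of_mem_same _ hx
  · exact DirectSum.decompose_of_mem_ne _ hx h

lemma finite_proj (M : GrMod 𝒜) (x : M.carrier) : {j | M.proj j x ≠ 0}.Finite := by
  classical
  let _ := M.isInternal.chooseDecomposition
  refine (DFinsupp.support (DirectSum.decompose M.piece x)).finite_toSet.subset fun j hj ↦ ?_
  simp only [Finset.mem_coe, DFinsupp.mem_support_toFun, ne_eq]
  intro h
  apply hj
  change ((DirectSum.decompose M.piece x j : M.piece j) : M.carrier) = _
  rw [h]
  rfl

lemma ext_proj (M : GrMod 𝒜) {x y : M.carrier} (h : ∀ j, M.proj j x = M.proj j y) : x = y := by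
  let _ := M.isInternal.chooseDecomposition
  apply (DirectSum.decompose M.piece).injective
  ext j
  exact h j

/-- A family of subgroups with compatible projections is an internal direct sum decomposition. -/
lemma isInternal_of_proj {X : Type u} [AddCommGroup X] (p : ℤ → AddSubgroup X)
    (π : ℤ → X →+ X) (hmem : ∀ j x, π j x ∈ p j)
    (hof : ∀ i j x, x ∈ p j → π i x = if j = i then x else 0)
    (hfin : ∀ x, {j | π j x ≠ 0}.Finite) (hext : ∀ x, (∀ j, π j x = 0) → x = 0) :
    DirectSum.IsInternal p := by
  classical
  have key : ∀ (v : DirectSum ℤ fun j ↦ p j) (i : ℤ),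
      π i (DirectSum.coeAddMonoidHom p v) = (v i : X) := by
    intro v i
    induction v using DirectSum.induction_on with
    | zero => simp
    | of j x =>
      rw [DirectSum.coeAddMonoidHom_of, hof i j x x.2, DirectSum.coe_of_apply]
      split_ifs <;> simp
    | add a b ha hb => simp [ha, hb]
  constructor
  · intro v w h
    ext i
    rw [← key, ← key, h]
  · intro x
    let v : DirectSum ℤ fun j ↦ p j :=
      DirectSum.mk (fun j ↦ p j) (hfin x).toFinset fun j ↦ ⟨π j x, hmem j x⟩
    refine ⟨v, sub_eq_zero.1 (hext _ fun i ↦ ?_)⟩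
    rw [map_sub, key, sub_eq_zero]
    by_cases hi : i ∈ (hfin x).toFinset
    · rw [DirectSum.mk_apply_of_mem hi]
    · rw [DirectSum.mk_apply_of_notMem hi]
      simpa [eq_comm] using hi

/-- The group of homomorphisms of graded modules, i.e. `R`-linear maps of degree zero. -/
def homs (M N : GrMod 𝒜) : AddSubgroup (M.carrier →ₗ[R] N.carrier) where
  carrier := {f | ∀ j, ∀ x ∈ M.piece j, f x ∈ N.piece j}
  zero_mem' := fun j _ _ ↦ (N.piece j).zero_mem
  add_mem' := fun hf hg j x hx ↦ (N.piece j).add_mem (hf j x hx) (hg j x hx)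
  neg_mem' := fun hf j x hx ↦ (N.piece j).neg_mem (hf j x hx)

/-- The category of graded `R`-modules and homomorphisms of degree zero. -/
instance : Category (GrMod 𝒜) where
  Hom M N := homs M N
  id M := ⟨LinearMap.id, fun _ _ hx ↦ hx⟩
  comp f g := ⟨g.1.comp f.1, fun j x hx ↦ g.2 j _ (f.2 j x hx)⟩

/-- The linear map underlying a homomorphism of graded modules. -/
def toLin {M N : GrMod 𝒜} (f : M ⟶ N) : M.carrier →ₗ[R] N.carrier := f.1

/-- A linear map of degree zero as a homomorphism of graded modules. -/
def ofLin {M N : GrMod 𝒜} (f : M.carrier →ₗ[R] N.carrier)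
    (hf : ∀ j, ∀ x ∈ M.piece j, f x ∈ N.piece j) : M ⟶ N := ⟨f, hf⟩

@[simp] lemma toLin_ofLin {M N : GrMod 𝒜} (f : M.carrier →ₗ[R] N.carrier)
    (hf : ∀ j, ∀ x ∈ M.piece j, f x ∈ N.piece j) : toLin (ofLin f hf) = f := rfl

@[simp] lemma toLin_id (M : GrMod 𝒜) : toLin (𝟙 M) = LinearMap.id := rfl

@[simp] lemma toLin_comp {M N P : GrMod 𝒜} (f : M ⟶ N) (g : N ⟶ P) :
    toLin (f ≫ g) = (toLin g).comp (toLin f) := rfl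

lemma toLin_mem {M N : GrMod 𝒜} (f : M ⟶ N) {j : ℤ} {x : M.carrier} (hx : x ∈ M.piece j) :
    toLin f x ∈ N.piece j := f.2 j x hx

lemma hom_ext {M N : GrMod 𝒜} {f g : M ⟶ N} (h : ∀ x, toLin f x = toLin g x) : f = g :=
  Subtype.ext (LinearMap.ext h)

lemma toLin_congr {M N : GrMod 𝒜} {f g : M ⟶ N} (h : f = g) (x : M.carrier) :
    toLin f x = toLin g x := by rw [h]

instance : Preadditive (GrMod 𝒜) where
  homGroup M N := inferInstanceAs (AddCommGroup (homs M N))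
  add_comp _ _ _ f f' g := hom_ext fun x ↦ map_add (toLin g) (toLin f x) (toLin f' x)
  comp_add _ _ _ _ _ _ := hom_ext fun _ ↦ rfl

@[simp] lemma toLin_zero (M N : GrMod 𝒜) : toLin (0 : M ⟶ N) = 0 := rfl

@[simp] lemma toLin_add {M N : GrMod 𝒜} (f g : M ⟶ N) : toLin (f + g) = toLin f + toLin g := rfl

lemma toLin_proj {M N : GrMod 𝒜} (f : M ⟶ N) (j : ℤ) (x : M.carrier) :
    toLin f (M.proj j x) = N.proj j (toLin f x) := by
  classical
  let _ := M.isInternal.chooseDecomposition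
  induction x using DirectSum.Decomposition.inductionOn M.piece with
  | zero => simp
  | @homogeneous i m =>
    rw [M.proj_of_mem m.2, N.proj_of_mem (toLin_mem f m.2)]
    split_ifs <;> simp
  | add a b ha hb => simp [ha, hb]

/-- Homogeneous submodules: those which contain the components of their elements. -/
def IsHomog (M : GrMod 𝒜) (P : Submodule R M.carrier) : Prop :=
  ∀ j, ∀ x ∈ P, M.proj j x ∈ P

/-- A homogeneous submodule as a graded module, with components `P ∩ Mⱼ`. -/
def sub (M : GrMod 𝒜) (P : Submodule R M.carrier) (hP : M.IsHomog P) : GrMod 𝒜 where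
  carrier := P
  piece j := (M.piece j).comap P.subtype.toAddMonoidHom
  isInternal := by
    refine isInternal_of_proj _
      (fun j ↦ ((M.proj j).comp P.subtype.toAddMonoidHom).codRestrict P.toAddSubgroup
        fun x ↦ hP j x x.2) (fun j x ↦ M.proj_mem j x) (fun i j x hx ↦ ?_) (fun x ↦ ?_)
        (fun x hx ↦ ?_)
    · apply Subtype.ext
      refine (M.proj_of_mem hx i).trans ?_
      split_ifs <;> rfl
    · refine (M.finite_proj x).subset fun j hj h ↦ hj (Subtype.ext h)
    · apply Subtype.ext
      refine M.ext_proj fun j ↦ (congrArg Subtype.val (hx j)).trans ?_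
      simp
  smul_mem := fun ha hx ↦ M.smul_mem ha hx

/-- The quotient by a homogeneous submodule, with components the images of the `Mⱼ`. -/
def quot (M : GrMod 𝒜) (P : Submodule R M.carrier) (hP : M.IsHomog P) : GrMod 𝒜 where
  carrier := M.carrier ⧸ P
  piece j := (M.piece j).map P.mkQ.toAddMonoidHom
  isInternal := by
    let π (j : ℤ) : M.carrier ⧸ P →+ M.carrier ⧸ P :=
      QuotientAddGroup.map P.toAddSubgroup P.toAddSubgroup (M.proj j) fun x hx ↦ hP j x hx
    have hπ : ∀ j x, π j (P.mkQ x) = P.mkQ (M.proj j x) := fun _ _ ↦ rfl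
    refine isInternal_of_proj _ π (fun j x ↦ ?_) (fun i j x hx ↦ ?_) (fun x ↦ ?_) (fun x hx ↦ ?_)
    · obtain ⟨x, rfl⟩ := P.mkQ_surjective x
      exact ⟨_, M.proj_mem j x, rfl⟩
    · obtain ⟨x, hx, rfl⟩ := hx
      refine (hπ i x).trans ?_
      rw [M.proj_of_mem hx i]
      split_ifs
      · rfl
      · simp
    · obtain ⟨x, rfl⟩ := P.mkQ_surjective x
      refine (M.finite_proj x).subset fun j hj h ↦ hj ?_
      rw [hπ, h, map_zero]
    · obtain ⟨x, rfl⟩ := P.mkQ_surjective x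
      classical
      let _ := M.isInternal.chooseDecomposition
      rw [← DirectSum.sum_support_decompose M.piece x, map_sum]
      refine Finset.sum_eq_zero fun j _ ↦ (hπ j x).symm.trans (hx j)
  smul_mem := by
    rintro i j a _ ha ⟨x, hx, rfl⟩
    exact ⟨a • x, M.smul_mem ha hx, rfl⟩

/-- The zero module. -/
def zeroObj : GrMod 𝒜 where
  carrier := PUnit
  piece _ := ⊥
  isInternal := isInternal_of_proj _ (fun _ ↦ 0) (fun _ _ ↦ rfl) (fun _ _ _ _ ↦ rfl)
    (fun x ↦ Set.Finite.subset Set.finite_empty fun _ hj ↦ hj rfl) (fun _ _ ↦ rfl)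
  smul_mem := fun _ _ ↦ rfl

instance : HasZeroObject (GrMod 𝒜) :=
  ⟨zeroObj, (IsZero.iff_id_eq_zero _).2 (hom_ext fun _ ↦ rfl)⟩

/-- The direct sum of two graded modules. -/
def prod (M N : GrMod 𝒜) : GrMod 𝒜 where
  carrier := M.carrier × N.carrier
  piece j := (M.piece j).prod (N.piece j)
  isInternal := by
    refine isInternal_of_proj _ (fun j ↦ (M.proj j).prodMap (N.proj j))
      (fun j x ↦ ⟨M.proj_mem j _, N.proj_mem j _⟩) (fun i j x hx ↦ ?_) (fun x ↦ ?_) (fun x hx ↦ ?_)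
    · have h1 := M.proj_of_mem hx.1 i
      have h2 := N.proj_of_mem hx.2 i
      refine (Prod.ext h1 h2 : (M.proj i x.1, N.proj i x.2) = (_, _)).trans ?_
      by_cases h : j = i
      · exact (congrArg₂ Prod.mk (if_pos h) (if_pos h)).trans (if_pos h).symm
      · exact (congrArg₂ Prod.mk (if_neg h) (if_neg h)).trans (if_neg h).symm
    · refine ((M.finite_proj x.1).union (N.finite_proj x.2)).subset fun j hj ↦ ?_
      by_contra h
      simp only [Set.mem_union, Set.mem_ofPred_eq, ne_eq, not_or, not_not] at h
      exact hj (Prod.ext h.1 h.2)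
    · refine Prod.ext (M.ext_proj fun j ↦ ?_) (N.ext_proj fun j ↦ ?_)
      · exact (congrArg Prod.fst (hx j)).trans (map_zero _).symm
      · exact (congrArg Prod.snd (hx j)).trans (map_zero _).symm
  smul_mem := fun ha hx ↦ ⟨M.smul_mem ha hx.1, N.smul_mem ha hx.2⟩

instance : HasBinaryBiproducts (GrMod 𝒜) where
  has_binary_biproduct M N := HasBinaryBiproduct.mk
    { bicone :=
        { pt := prod M N
          fst := ofLin (LinearMap.fst R _ _) fun _ _ hx ↦ hx.1
          snd := ofLin (LinearMap.snd R _ _) fun _ _ hx ↦ hx.2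
          inl := ofLin (LinearMap.inl R _ _) fun j _ hx ↦ ⟨hx, (N.piece j).zero_mem⟩
          inr := ofLin (LinearMap.inr R _ _) fun j _ hx ↦ ⟨(M.piece j).zero_mem, hx⟩
          inl_fst := rfl
          inl_snd := rfl
          inr_fst := rfl
          inr_snd := rfl }
      isBilimit := isBinaryBilimitOfTotal _ <| hom_ext fun x ↦ by
        change ((x.1, 0) + (0, x.2) : M.carrier × N.carrier) = x
        exact Prod.ext (add_zero _) (zero_add _) }

instance : HasFiniteProducts (GrMod 𝒜) :=
  hasFiniteProducts_of_has_binary_and_terminal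

lemma isHomog_ker {M N : GrMod 𝒜} (f : M ⟶ N) : M.IsHomog (LinearMap.ker (toLin f)) :=
  fun j x hx ↦ by rw [LinearMap.mem_ker] at hx ⊢; rw [toLin_proj, hx, map_zero]

lemma isHomog_range {M N : GrMod 𝒜} (f : M ⟶ N) : N.IsHomog (LinearMap.range (toLin f)) := by
  rintro j _ ⟨x, rfl⟩
  exact ⟨M.proj j x, toLin_proj f j x⟩

/-- The inclusion of a homogeneous submodule. -/
def subι (M : GrMod 𝒜) (P : Submodule R M.carrier) (hP : M.IsHomog P) : M.sub P hP ⟶ M :=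
  ofLin P.subtype fun _ _ hx ↦ hx

/-- The projection to the quotient by a homogeneous submodule. -/
def quotπ (M : GrMod 𝒜) (P : Submodule R M.carrier) (hP : M.IsHomog P) : M ⟶ M.quot P hP :=
  ofLin P.mkQ fun _ x hx ↦ ⟨x, hx, rfl⟩

/-- Factorization through a homogeneous submodule. -/
def subLift {M N : GrMod 𝒜} {P : Submodule R M.carrier} (hP : M.IsHomog P) (g : N ⟶ M)
    (hg : ∀ x, toLin g x ∈ P) : N ⟶ M.sub P hP :=
  ofLin ((toLin g).codRestrict P hg) fun _ _ hx ↦ toLin_mem g hx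

/-- Factorization through the quotient by a homogeneous submodule. -/
def quotDesc {M N : GrMod 𝒜} {P : Submodule R M.carrier} (hP : M.IsHomog P) (g : M ⟶ N)
    (hg : ∀ x ∈ P, toLin g x = 0) : M.quot P hP ⟶ N :=
  ofLin (P.liftQ (toLin g) hg) fun _ _ hx ↦ by
    obtain ⟨x, hx, rfl⟩ := hx
    exact toLin_mem g hx

instance : HasKernels (GrMod 𝒜) where
  has_limit {M N} f := ⟨⟨{
    cone := KernelFork.ofι (M.subι _ (isHomog_ker f)) (hom_ext fun x ↦ x.2)
    isLimit := KernelFork.IsLimit.ofι _ _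
      (fun g hg ↦ subLift (isHomog_ker f) g fun x ↦ toLin_congr hg x)
      (fun _ _ ↦ hom_ext fun _ ↦ rfl)
      (fun _ _ _ hm ↦ hom_ext fun x ↦ Subtype.ext (toLin_congr hm x)) }⟩⟩

instance : HasCokernels (GrMod 𝒜) where
  has_colimit {M N} f := ⟨⟨{
    cocone := CokernelCofork.ofπ (N.quotπ _ (isHomog_range f))
      (hom_ext fun x ↦ (Submodule.Quotient.mk_eq_zero _).2 ⟨x, rfl⟩)
    isColimit := CokernelCofork.IsColimit.ofπ _ _
      (fun g hg ↦ quotDesc (isHomog_range f) g (by rintro _ ⟨x, rfl⟩; exact toLin_congr hg x))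
      (fun _ _ ↦ hom_ext fun _ ↦ rfl)
      (fun _ _ _ hm ↦ hom_ext fun x ↦ by
        obtain ⟨x, rfl⟩ := Submodule.mkQ_surjective _ x
        exact toLin_congr hm x) }⟩⟩

lemma injective_of_mono {M N : GrMod 𝒜} (f : M ⟶ N) [Mono f] :
    Function.Injective (toLin f) := by
  rw [injective_iff_map_eq_zero]
  intro x hx
  have h : M.subι _ (isHomog_ker f) = 0 := by
    rw [← cancel_mono f]
    exact hom_ext fun y ↦ y.2.trans (map_zero (toLin f)).symm
  exact toLin_congr h ⟨x, hx⟩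

lemma surjective_of_epi {M N : GrMod 𝒜} (f : M ⟶ N) [Epi f] :
    Function.Surjective (toLin f) := by
  have h : N.quotπ _ (isHomog_range f) = 0 := by
    rw [← cancel_epi f]
    exact hom_ext fun x ↦ (Submodule.Quotient.mk_eq_zero _).2 ⟨x, rfl⟩
  intro y
  exact (Submodule.Quotient.mk_eq_zero _).1 (toLin_congr h y)

lemma mem_piece_of_injective {M N : GrMod 𝒜} (f : M ⟶ N) (hf : Function.Injective (toLin f))
    {j : ℤ} {x : M.carrier} (hx : toLin f x ∈ N.piece j) : x ∈ M.piece j := by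
  have h : M.proj j x = x := hf (by rw [toLin_proj, N.proj_of_mem hx, if_pos rfl])
  exact h ▸ M.proj_mem j x

lemma exists_mem_piece_of_surjective {M N : GrMod 𝒜} (f : M ⟶ N)
    (hf : Function.Surjective (toLin f)) {j : ℤ} {y : N.carrier} (hy : y ∈ N.piece j) :
    ∃ x ∈ M.piece j, toLin f x = y := by
  obtain ⟨x, rfl⟩ := hf y
  exact ⟨M.proj j x, M.proj_mem j x, by rw [toLin_proj, N.proj_of_mem hy, if_pos rfl]⟩

instance : IsNormalMonoCategory (GrMod 𝒜) where
  normalMonoOfMono {M N} f _ := ⟨{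
    Z := N.quot _ (isHomog_range f)
    g := N.quotπ _ (isHomog_range f)
    w := hom_ext fun x ↦ (Submodule.Quotient.mk_eq_zero _).2 ⟨x, rfl⟩
    isLimit :=
      have hinj := injective_of_mono f
      let e := LinearEquiv.ofInjective (toLin f) hinj
      have he (y) : toLin f (e.symm y) = y.1 :=
        congrArg Subtype.val (e.apply_symm_apply y)
      KernelFork.IsLimit.ofι _ _
        (fun {W} g hg ↦
          have hr (x : W.carrier) : toLin g x ∈ LinearMap.range (toLin f) :=
            (Submodule.Quotient.mk_eq_zero _).1 (toLin_congr hg x)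
          ofLin (e.symm.toLinearMap.comp ((toLin g).codRestrict _ hr)) fun j x hx ↦
            mem_piece_of_injective f hinj (by
              rw [LinearMap.comp_apply, LinearEquiv.coe_coe, he]
              exact toLin_mem g hx))
        (fun _ _ ↦ hom_ext fun _ ↦ he _)
        (fun _ _ _ hm ↦ hom_ext fun x ↦ by
          apply hinj
          rw [toLin_ofLin, LinearMap.comp_apply, LinearEquiv.coe_coe, he]
          exact toLin_congr hm x) }⟩

instance : IsNormalEpiCategory (GrMod 𝒜) where
  normalEpiOfEpi {M N} f _ := ⟨{
    W := M.sub _ (isHomog_ker f)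
    g := M.subι _ (isHomog_ker f)
    w := hom_ext fun x ↦ x.2
    isColimit :=
      have hsurj := surjective_of_epi f
      let e := LinearMap.quotKerEquivOfSurjective (toLin f) hsurj
      have he (x) : e.symm (toLin f x) = (LinearMap.ker (toLin f)).mkQ x :=
        (e.symm_apply_eq).2 rfl
      CokernelCofork.IsColimit.ofπ _ _
        (fun {W} g hg ↦
          have hk : LinearMap.ker (toLin f) ≤ LinearMap.ker (toLin g) :=
            fun x hx ↦ toLin_congr hg ⟨x, hx⟩
          ofLin (((LinearMap.ker (toLin f)).liftQ (toLin g) hk).comp e.symm.toLinearMap)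
            fun j y hy ↦ by
              obtain ⟨x, hx, rfl⟩ := exists_mem_piece_of_surjective f hsurj hy
              rw [LinearMap.comp_apply, LinearEquiv.coe_coe, he]
              exact toLin_mem g hx)
        (fun g hg ↦ hom_ext fun x ↦ by
          rw [toLin_comp, toLin_ofLin, LinearMap.comp_apply, LinearMap.comp_apply,
            LinearEquiv.coe_coe, he]
          rfl)
        (fun g hg m hm ↦ hom_ext fun y ↦ by
          obtain ⟨x, rfl⟩ := hsurj y
          rw [toLin_ofLin, LinearMap.comp_apply, LinearEquiv.coe_coe, he]
          exact toLin_congr hm x) }⟩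

instance : Abelian (GrMod 𝒜) where

instance : HasExt.{u + 1} (GrMod 𝒜) := HasExt.standard _

/-- The shifted module `M(n)`, with `M(n)ⱼ = Mⱼ₊ₙ`. -/
def shift (M : GrMod 𝒜) (n : ℤ) : GrMod 𝒜 where
  carrier := M.carrier
  piece j := M.piece (j + n)
  isInternal := by
    refine isInternal_of_proj _ (fun j ↦ M.proj (j + n)) (fun j x ↦ M.proj_mem _ x)
      (fun i j x hx ↦ ?_) (fun x ↦ ?_) (fun x hx ↦ ?_)
    · simp [M.proj_of_mem hx]
    · exact (M.finite_proj x).preimage (add_left_injective n).injOn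
    · refine M.ext_proj fun j ↦ ?_
      simpa using hx (j - n)
  smul_mem := fun ha hx ↦ by simpa [add_assoc] using M.smul_mem ha hx

/-- An `R`-module killed by all elements of positive degree, regarded as a graded module
concentrated in degree zero. -/
def concentrated (V : Type u) [AddCommGroup V] [Module R V]
    (h : ∀ i : ℕ, 0 < i → ∀ a ∈ 𝒜 i, ∀ x : V, a • x = 0) : GrMod 𝒜 where
  carrier := V
  piece j := if j = 0 then ⊤ else ⊥
  isInternal := by
    refine isInternal_of_proj _ (fun j ↦ if j = 0 then AddMonoidHom.id V else 0)
      (fun j x ↦ ?_) (fun i j x hx ↦ ?_) (fun x ↦ ?_) (fun x hx ↦ ?_)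
    · by_cases hj : j = 0 <;> simp [hj]
    · by_cases hj : j = 0
      · subst hj
        by_cases hi : i = 0
        · simp [hi]
        · simp [hi, Ne.symm hi]
      · have : x = 0 := by simpa [hj] using hx
        simp [this]
    · refine (Set.finite_singleton (0 : ℤ)).subset fun j hj ↦ ?_
      by_contra hj'
      have : j ≠ 0 := hj'
      simp [this] at hj
    · simpa using hx 0
  smul_mem := by
    intro i j a x ha hx
    by_cases hj : j = 0
    · subst hj
      rcases Nat.eq_zero_or_pos i with rfl | hi
      · simp
      · rw [h i hi a ha x]
        exact zero_mem _
    · have : x = 0 := by simpa [hj] using hx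
      rw [this, smul_zero]
      exact zero_mem _

variable [GradedAlgebra 𝒜]

lemma isHomog_smul_top (M : GrMod 𝒜) {I : Ideal R} (hI : I.IsHomogeneous 𝒜) :
    M.IsHomog (I • (⊤ : Submodule R M.carrier)) := by
  classical
  intro j x hx
  induction hx using Submodule.smul_induction_on' with
  | smul a ha m hm =>
    let _ := M.isInternal.chooseDecomposition
    rw [← DirectSum.sum_support_decompose 𝒜 a, Finset.sum_smul, map_sum]
    refine Submodule.sum_mem _ fun i _ ↦ ?_
    rw [← DirectSum.sum_support_decompose M.piece m, Finset.smul_sum, map_sum]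
    refine Submodule.sum_mem _ fun l _ ↦ ?_
    rw [M.proj_of_mem (M.smul_mem (SetLike.coe_mem _) (SetLike.coe_mem _))]
    split_ifs
    · exact Submodule.smul_mem_smul (hI i ha) trivial
    · exact zero_mem _
  | add x _ y _ hx hy => rw [map_add]; exact add_mem hx hy

variable (𝒜) in
/-- The ideal `R₊` generated by the elements of positive degree. -/
def irr : Ideal R := (HomogeneousIdeal.irrelevant 𝒜).toIdeal

lemma isHomog_irr_pow (M : GrMod 𝒜) (n : ℕ) :
    M.IsHomog (irr 𝒜 ^ n • (⊤ : Submodule R M.carrier)) :=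
  M.isHomog_smul_top <| by
    induction n with
    | zero => rw [pow_zero, Ideal.one_eq_top]; exact Ideal.IsHomogeneous.top 𝒜
    | succ n ih => rw [pow_succ]; exact ih.mul (HomogeneousIdeal.irrelevant 𝒜).isHomogeneous

/-- The inverse system `⋯ → M / R₊²M → M / R₊M → M / M = 0` of graded modules. -/
def tower (M : GrMod 𝒜) : ℕᵒᵖ ⥤ GrMod 𝒜 where
  obj n := M.quot _ (M.isHomog_irr_pow n.unop)
  map {m n} h := quotDesc _ (M.quotπ _ (M.isHomog_irr_pow n.unop)) fun x hx ↦
    (Submodule.Quotient.mk_eq_zero _).2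
      (Submodule.smul_mono_left (Ideal.pow_le_pow_right (leOfHom h.unop)) hx)
  map_id _ := hom_ext fun x ↦ by
    obtain ⟨x, rfl⟩ := Submodule.mkQ_surjective _ x
    rfl
  map_comp _ _ := hom_ext fun x ↦ by
    obtain ⟨x, rfl⟩ := Submodule.mkQ_surjective _ x
    rfl

/-- The component of degree `μ` of the generalized local cohomology module
`Hⁱ(M, N) = colimₙ Extⁱ(M / R₊ⁿM, N)` with support in `R₊`. The component of degree `μ` of
`Extⁱ(P, N)`, for `P` finitely generated over the Noetherian ring `R`, is the group of
extensions of `P` by `N(μ)` in the category of graded modules. -/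
def genLocalCohomology (M N : GrMod 𝒜) (i : ℕ) (μ : ℤ) : AddCommGrpCat.{u + 1} :=
  colimit (M.tower.rightOp ⋙ (Abelian.extFunctor i).flip.obj (N.shift μ))

/-- The largest degree of a nonzero element of `Hⁱ(M, N)`, in `ℤ ∪ {±∞}`
(`-∞` if the module is zero, `+∞` if there is no largest degree). -/
def aInvariant (M N : GrMod 𝒜) (i : ℕ) : EReal :=
  ⨆ (μ : ℤ) (_ : Nontrivial (genLocalCohomology M N i μ)), ((μ : ℝ) : EReal)

/-- The generalized regularity `reg (M, N) = sup {end (Hⁱ(M, N)) + i}`, in `ℤ ∪ {±∞}`. -/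
def reg (M N : GrMod 𝒜) : EReal :=
  ⨆ i : ℕ, aInvariant M N i + (i : EReal)

variable (𝒜) in
/-- The residue field `k` of the local ring `R₀`, as a graded `R`-module concentrated in degree
zero; it is the quotient of `R` by the ideal generated by the maximal ideal of `R₀` and `R₊`. -/
def residueField [IsLocalRing R₀] : GrMod 𝒜 :=
  concentrated (R ⧸ (IsLocalRing.maximalIdeal R₀).map (algebraMap R₀ R) ⊔ irr 𝒜)
    fun i hi a ha x ↦ by
      obtain ⟨x, rfl⟩ := Ideal.Quotient.mk_surjective x
      rw [Algebra.smul_def, Ideal.Quotient.algebraMap_eq, ← map_mul, Ideal.Quotient.eq_zero_iff_mem]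
      refine Ideal.mul_mem_right _ _ (Ideal.mem_sup_right ?_)
      exact HomogeneousIdeal.mem_irrelevant_of_mem 𝒜 hi ha

end GrMod

end

/-!
Let `d = dim R₀`. The equivalence of the two conditions is the statement that a finite module over
a regular local ring which has depth `d` is free, applied to the components `R_μ`: they are finite
over `R₀` (`IsStandardGraded.isNoetherian_component`) and are direct summands of `R`, so an
`R`-regular sequence is regular on them. Freeness (`free_of_isWeaklyRegular`) is proved by induction
on `d`, dividing by an element `x ∈ 𝔪 ∖ 𝔪²` regular on the module. The induction needs that the depth
drops by just one for every choice of `x` (`exists_isWeaklyRegular_quotSMulTop`). Conversely, `𝔪₀`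
is generated by a regular sequence of length `d`
(`exists_isWeaklyRegular_ofList_eq_maximalIdeal`), which stays regular on a free `R₀`-module.

For the regularity, `R₊` kills `k`, so the direct system defining `Hⁱ(k, k)` is constant and
`Hⁱ(k, k)` is `Extⁱ(k, k)`. These groups are reached in two steps from the graded module
`R₀ = R / R₊`.

* Since the components of `R` are free over `R₀`, a graded module `M` with free components in
  degrees `≥ a` is covered by a graded free module whose generators are bases of the `M_j`; the
  kernel has free components again, and lives in degrees `≥ a + 1` because the cover is an
  isomorphism in degree `a`. Dimension shifting gives `Extⁱ(M, k(μ)) = 0` for `i + μ + a > 0`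
  (`GrMod.ext_eq_zero_of_hasFreeComponents`). For `M = R₀` this is the bound `i + μ ≤ 0`.
* If `r₁, …, r_d` is a regular sequence generating `𝔪₀`, the sequences
  `0 → R₀/(r₁, …, rₙ) → R₀/(r₁, …, rₙ) → R₀/(r₁, …, rₙ₊₁) → 0` given by multiplication by `rₙ₊₁`
  raise the bound by one at each step. As `rₙ₊₁` kills `k`, hence acts by zero on `Ext(-, k(μ))`,
  their connecting maps are injective, so the nonzero element `R₀ → k` of `Ext⁰(R₀, k)` gives a
  nonzero element of `Extᵈ(k, k)` in degree zero (`GrMod.ext_baseQuot_take`).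
-/

open CategoryTheory CategoryTheory.Limits IsLocalRing RingTheory.Sequence
open scoped Pointwise

/-! ### Depth over Noetherian local rings -/

section Depth

variable {A : Type*} [CommRing A] [IsLocalRing A]

/-- Prime avoidance, with one ideal `J` of the family allowed not to be prime. -/
lemma exists_mem_maximalIdeal_forall_notMem {S : Set (Ideal A)} (hS : S.Finite) (J : Ideal A)
    (hp : ∀ p ∈ S, p ≠ J → p.IsPrime) (hm : ∀ p ∈ S, ¬ maximalIdeal A ≤ p) :
    ∃ x ∈ maximalIdeal A, ∀ p ∈ S, x ∉ p := by
  by_contra! h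
  have hsub : (maximalIdeal A : Set A) ⊆
      ⋃ p ∈ (hS.toFinset : Set (Ideal A)), (id p : Ideal A) := by
    intro x hx
    obtain ⟨p, hpS, hxp⟩ := h x hx
    exact Set.mem_biUnion (by simpa using hpS) hxp
  obtain ⟨p, hpS, hle⟩ := (Ideal.subset_union_prime (f := id) J J
    fun p hpS hpJ _ ↦ hp p (by simpa using hpS) hpJ).1 hsub
  exact hm p (by simpa using hpS) hle

variable [IsNoetherianRing A] {M : Type*} [AddCommGroup M] [Module A M]

lemma isSMulRegular_iff_forall_associatedPrimes {A : Type*} [CommRing A] [IsNoetherianRing A]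
    {M : Type*} [AddCommGroup M] [Module A M] (x : A) :
    IsSMulRegular M x ↔ ∀ p ∈ associatedPrimes A M, x ∉ p := by
  have h := biUnion_associatedPrimes_eq_compl_regular A M
  have hx : x ∈ (⋃ p ∈ associatedPrimes A M, (p : Set A)) ↔ ¬ IsSMulRegular M x := by
    rw [h]; rfl
  simp only [Set.mem_iUnion, SetLike.mem_coe, exists_prop] at hx
  rw [← not_iff_not, ← hx]
  push Not
  rfl

/-- If `r, s` is a regular sequence on `M` in the maximal ideal and `x` is regular on `M`, then the
maximal ideal is not associated to `M / xM`: multiplication by `r / x` would carry a socle element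
of `M / xM` to a socle element of `M / rM`. -/
lemma maximalIdeal_notMem_associatedPrimes_quotSMulTop {r s x : A}
    (hr : r ∈ maximalIdeal A) (hs : s ∈ maximalIdeal A)
    (hrM : IsSMulRegular M r) (hsM : IsSMulRegular (QuotSMulTop r M) s)
    (hxM : IsSMulRegular M x) :
    maximalIdeal A ∉ associatedPrimes A (QuotSMulTop x M) := by
  intro hm
  obtain ⟨-, f, hf⟩ := (isAssociatedPrime_iff_exists_injective_linearMap _ _).1 hm
  obtain ⟨u, hu⟩ := Submodule.mkQ_surjective _ (f 1)
  have hu0 : u ∉ x • (⊤ : Submodule A M) := fun h ↦ by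
    rw [← Submodule.Quotient.mk_eq_zero, ← Submodule.mkQ_apply, hu, map_eq_zero_iff f hf] at h
    exact one_ne_zero h
  have hmu : ∀ a ∈ maximalIdeal A, ∃ w, x • w = a • u := fun a ha ↦ by
    have : a • u ∈ x • (⊤ : Submodule A M) := by
      rw [← Submodule.Quotient.mk_eq_zero, ← Submodule.mkQ_apply, map_smul, hu, ← map_smul,
        Algebra.smul_def, mul_one, Ideal.Quotient.algebraMap_eq,
        Ideal.Quotient.eq_zero_iff_mem.2 ha, map_zero]
    obtain ⟨w, -, hw⟩ := (Submodule.mem_smul_pointwise_iff_exists _ _ _).1 this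
    exact ⟨w, hw⟩
  -- The class of `u` is a socle element of `M / xM`; with `ru = xv`, that of `v` is one of `M / rM`.
  obtain ⟨v, hv⟩ := hmu r hr
  obtain ⟨w, hw⟩ := hmu s hs
  have hsv : s • v ∈ r • (⊤ : Submodule A M) := by
    refine (Submodule.mem_smul_pointwise_iff_exists _ _ _).2 ⟨w, trivial, hxM ?_⟩
    change x • r • w = x • s • v
    rw [smul_comm x r, hw, smul_comm x s, hv, smul_comm]
  obtain ⟨v', -, hv'⟩ := (Submodule.mem_smul_pointwise_iff_exists _ _ _).1
    ((isSMulRegular_quotient_iff_mem_of_smul_mem _ _).1 hsM v hsv)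
  refine hu0 ((Submodule.mem_smul_pointwise_iff_exists _ _ _).2 ⟨v', trivial, hrM ?_⟩)
  change r • x • v' = r • u
  rw [← hv, ← hv', smul_comm]

variable [Module.Finite A M]

/-- The maximal ideal is associated to none of the three modules, so prime avoidance gives a common
regular element. -/
lemma exists_isSMulRegular_three {r s x : A}
    (hr : r ∈ maximalIdeal A) (hs : s ∈ maximalIdeal A)
    (hrM : IsSMulRegular M r) (hsM : IsSMulRegular (QuotSMulTop r M) s)
    (hxM : IsSMulRegular M x) :
    ∃ y ∈ maximalIdeal A, IsSMulRegular M y ∧ IsSMulRegular (QuotSMulTop r M) y ∧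
      IsSMulRegular (QuotSMulTop x M) y := by
  have hle {p : Ideal A} (hp : p.IsPrime) (h : maximalIdeal A ≤ p) : maximalIdeal A = p :=
    (maximalIdeal.isMaximal A).eq_of_le hp.ne_top h
  obtain ⟨y, hy, h⟩ := exists_mem_maximalIdeal_forall_notMem
    (S := associatedPrimes A M ∪ associatedPrimes A (QuotSMulTop r M) ∪
      associatedPrimes A (QuotSMulTop x M))
    (((associatedPrimes.finite A M).union (associatedPrimes.finite A _)).union
      (associatedPrimes.finite A _)) ⊥
    (by rintro p ((hp | hp) | hp) - <;> exact hp.1) (by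
      rintro p ((hp | hp) | hp) hm
      · exact (isSMulRegular_iff_forall_associatedPrimes r).1 hrM p hp (hm hr)
      · exact (isSMulRegular_iff_forall_associatedPrimes s).1 hsM p hp (hm hs)
      · exact maximalIdeal_notMem_associatedPrimes_quotSMulTop hr hs hrM hsM hxM
          (hle hp.1 hm ▸ hp))
  simp only [isSMulRegular_iff_forall_associatedPrimes]
  exact ⟨y, hy, fun p hp ↦ h p (.inl (.inl hp)), fun p hp ↦ h p (.inl (.inr hp)),
    fun p hp ↦ h p (.inr hp)⟩

/-- Depth drops by at most one modulo *any* regular element of the maximal ideal. The proof is an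
exchange argument: an element `y` regular on `M`, `M / rM` and `M / xM` allows to pass from the
given sequence `r, …` to one starting with `y`, and from that to one starting with `x`. -/
lemma exists_isWeaklyRegular_quotSMulTop (n : ℕ) {rs : List A} (hlen : rs.length = n + 1)
    (hrs : ∀ r ∈ rs, r ∈ maximalIdeal A) (h : IsWeaklyRegular M rs)
    {x : A} (hx : x ∈ maximalIdeal A) (hxM : IsSMulRegular M x) :
    ∃ ts : List A, ts.length = n ∧ (∀ t ∈ ts, t ∈ maximalIdeal A) ∧
      IsWeaklyRegular (QuotSMulTop x M) ts := by
  induction n generalizing M rs x with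
  | zero => exact ⟨[], rfl, by simp, IsWeaklyRegular.nil _ _⟩
  | succ n ih =>
    obtain _ | ⟨r, _ | ⟨s, rs⟩⟩ := rs
    · simp at hlen
    · simp at hlen
    have hr : r ∈ maximalIdeal A := hrs r (by simp)
    have hs : s ∈ maximalIdeal A := hrs s (by simp)
    obtain ⟨hrM, h⟩ := (isWeaklyRegular_cons_iff M r _).1 h
    have hsM := ((isWeaklyRegular_cons_iff _ s _).1 h).1
    obtain ⟨y, hy, hyM, hyr, hyx⟩ := exists_isSMulRegular_three hr hs hrM hsM hxM
    -- From `r, s, …` on `M` to a sequence `y, r, …` of the same length.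
    have hyr' : ∃ ts : List A, ts.length = n + 1 ∧ (∀ t ∈ ts, t ∈ maximalIdeal A) ∧
        IsWeaklyRegular (QuotSMulTop y M) ts := by
      obtain ⟨ts, hts, htm, ht⟩ := ih (by simpa using hlen)
        (fun t ht ↦ hrs t (List.mem_cons_of_mem _ ht)) h hy hyr
      have h1 : IsWeaklyRegular M (r :: y :: ts) := .cons hrM (.cons hyr ht)
      have h2 := IsLocalRing.isWeaklyRegular_of_perm_of_subset_maximalIdeal h1
        (List.Perm.swap y r ts) (by simp only [List.forall_mem_cons]; exact ⟨hr, hy, htm⟩)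
      exact ⟨r :: ts, by simp [hts], List.forall_mem_cons.2 ⟨hr, htm⟩,
        ((isWeaklyRegular_cons_iff M y _).1 h2).2⟩
    obtain ⟨ts, hts, htm, ht⟩ := hyr'
    have hxy : IsSMulRegular (QuotSMulTop y M) x := by
      have h1 : IsWeaklyRegular M [x, y] := .cons hxM (.cons hyx (.nil _ _))
      have h2 := IsLocalRing.isWeaklyRegular_of_perm_of_subset_maximalIdeal h1
        (List.Perm.swap y x []) (by simp only [List.forall_mem_cons]; exact ⟨hx, hy, by simp⟩)
      exact ((isWeaklyRegular_cons_iff _ x _).1 ((isWeaklyRegular_cons_iff M y _).1 h2).2).1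
    -- From a sequence on `M / yM` to one starting with `x`, so that `x, y, …` is regular on `M`.
    obtain ⟨us, hus, hum, hu⟩ := ih hts htm ht hx hxy
    have h1 : IsWeaklyRegular M (y :: x :: us) := .cons hyM (.cons hxy hu)
    have h2 := IsLocalRing.isWeaklyRegular_of_perm_of_subset_maximalIdeal h1
      (List.Perm.swap x y us) (by simp only [List.forall_mem_cons]; exact ⟨hy, hx, hum⟩)
    exact ⟨y :: us, by simp [hus], List.forall_mem_cons.2 ⟨hy, hum⟩,
      ((isWeaklyRegular_cons_iff M x _).1 h2).2⟩

end Depth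

/-! ### Regular local rings -/

section RegularLocal

variable {A : Type*} [CommRing A]

lemma exists_span_range_eq_maximalIdeal [IsRegularLocalRing A] {d : ℕ} (hd : ringKrullDim A = d) :
    ∃ v : Fin d → A, Ideal.span (Set.range v) = maximalIdeal A := by
  obtain ⟨s, hs, hspan⟩ := Submodule.FG.exists_span_finset_card_eq_spanFinrank
    (IsNoetherian.noetherian (maximalIdeal A))
  have hsd : s.card = d := by
    have := IsRegularLocalRing.spanFinrank_maximalIdeal (R := A)
    rw [hd] at this
    rw [hs]
    exact_mod_cast this
  let e := s.equivFinOfCardEq hsd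
  refine ⟨fun i ↦ e.symm i, ?_⟩
  rw [← hspan, Set.range_comp' Subtype.val, e.symm.range_eq_univ]
  simp [Ideal.span]

/-- An element of `𝔪 ∖ 𝔪²` can replace one of the members of a generating family of `𝔪`. -/
lemma exists_span_insert_eq_maximalIdeal [IsLocalRing A] {d : ℕ} {v : Fin (d + 1) → A}
    (hv : Ideal.span (Set.range v) = maximalIdeal A) {x : A} (hx : x ∈ maximalIdeal A)
    (hx2 : x ∉ maximalIdeal A ^ 2) :
    ∃ w : Fin d → A, Ideal.span (insert x (Set.range w)) = maximalIdeal A := by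
  have hvm (i) : v i ∈ maximalIdeal A := hv ▸ Ideal.subset_span ⟨i, rfl⟩
  obtain ⟨c, hc⟩ := (Submodule.mem_span_range_iff_exists_fun A).1 (hv ▸ hx)
  obtain ⟨j, hj⟩ : ∃ j, c j ∉ maximalIdeal A := by
    by_contra! h
    refine hx2 (hc ▸ Ideal.sum_mem _ fun i _ ↦ ?_)
    rw [pow_two]
    exact Ideal.mul_mem_mul (h i) (hvm i)
  obtain ⟨u, hu⟩ : IsUnit (c j) := by simpa using hj
  refine ⟨fun i ↦ v (j.succAbove i), le_antisymm ?_ ?_⟩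
  · rw [Ideal.span_le, Set.insert_subset_iff]
    exact ⟨hx, by rintro _ ⟨i, rfl⟩; exact hvm _⟩
  · rw [← hv, Ideal.span_le]
    set I := Ideal.span (insert x (Set.range fun i ↦ v (j.succAbove i))) with hI
    have hI' (i) : v (j.succAbove i) ∈ I := Ideal.subset_span (.inr ⟨i, rfl⟩)
    rintro _ ⟨i, rfl⟩
    rcases Fin.eq_self_or_eq_succAbove j i with rfl | ⟨i, rfl⟩
    · rw [Fin.sum_univ_succAbove _ i] at hc
      have h1 : c i • v i ∈ I := by
        rw [eq_sub_of_add_eq hc]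
        exact sub_mem (Ideal.subset_span (.inl rfl))
          (Ideal.sum_mem _ fun k _ ↦ Ideal.mul_mem_left _ _ (hI' k))
      rw [← hu, smul_eq_mul] at h1
      exact (Ideal.unit_mul_mem_iff_mem I u.isUnit).1 h1
    · exact hI' i

lemma isLocalRing_quotient_span_singleton [IsLocalRing A] {x : A} (hx : x ∈ maximalIdeal A) :
    IsLocalRing (A ⧸ Ideal.span {x}) :=
  have : Nontrivial (A ⧸ Ideal.span {x}) := Ideal.Quotient.nontrivial_iff.2 fun h ↦
    (maximalIdeal.isMaximal A).ne_top (top_le_iff.1 (h ▸ (Ideal.span_singleton_le_iff_mem _).2 hx))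
  .of_surjective' (Ideal.Quotient.mk _) Ideal.Quotient.mk_surjective

lemma maximalIdeal_quotient [IsLocalRing A] (I : Ideal A) [IsLocalRing (A ⧸ I)] :
    maximalIdeal (A ⧸ I) = (maximalIdeal A).map (Ideal.Quotient.mk I) := by
  have := IsLocalHom.of_surjective (Ideal.Quotient.mk I) Ideal.Quotient.mk_surjective
  rw [← IsLocalRing.maximalIdeal_comap (Ideal.Quotient.mk I),
    Ideal.map_comap_of_surjective _ Ideal.Quotient.mk_surjective]

/-- Cutting a regular local ring by an element of `𝔪 ∖ 𝔪²` gives a regular local ring of dimension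
one less. -/
lemma isRegularLocalRing_quotient_span_singleton [IsRegularLocalRing A] {d : ℕ}
    (hd : ringKrullDim A = (d + 1 : ℕ)) {x : A} (hx : x ∈ maximalIdeal A)
    (hx2 : x ∉ maximalIdeal A ^ 2) :
    IsRegularLocalRing (A ⧸ Ideal.span {x}) ∧ ringKrullDim (A ⧸ Ideal.span {x}) = d := by
  have := isLocalRing_quotient_span_singleton hx
  obtain ⟨v, hv⟩ := exists_span_range_eq_maximalIdeal hd
  obtain ⟨w, hw⟩ := exists_span_insert_eq_maximalIdeal hv hx hx2
  have hle : (maximalIdeal (A ⧸ Ideal.span {x})).spanFinrank ≤ d := by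
    have h1 : maximalIdeal (A ⧸ Ideal.span {x}) =
        Submodule.span _ (Set.range fun i ↦ Ideal.Quotient.mk (Ideal.span {x}) (w i)) := by
      rw [maximalIdeal_quotient, ← hw, Ideal.map_span, Set.image_insert_eq, ← Set.range_comp,
        Ideal.Quotient.eq_zero_iff_mem.2 (Ideal.mem_span_singleton_self x)]
      exact Submodule.span_insert_zero
    rw [h1]
    refine (Submodule.spanFinrank_span_le_ncard_of_finite (Set.finite_range _)).trans ?_
    rw [← Set.image_univ]
    exact (Set.ncard_image_le Set.finite_univ).trans (by simp)
  have hge : (d : WithBot ℕ∞) ≤ ringKrullDim (A ⧸ Ideal.span {x}) := by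
    have h1 := ringKrullDim_le_ringKrullDim_quotient_add_spanFinrank (Ideal.span {x})
      (by rw [IsLocalRing.ringJacobson_eq_maximalIdeal]
          exact (Ideal.span_singleton_le_iff_mem _).2 hx)
    have h2 : (Ideal.span {x}).spanFinrank ≤ 1 := by
      simpa using Submodule.spanFinrank_span_le_ncard_of_finite (R := A) (Set.finite_singleton x)
    rw [hd] at h1
    have h3 : ((d + 1 : ℕ) : WithBot ℕ∞) ≤ ringKrullDim (A ⧸ Ideal.span {x}) + 1 :=
      h1.trans (by gcongr; exact_mod_cast h2)
    rw [Nat.cast_add, Nat.cast_one] at h3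
    exact (ENat.WithBot.add_le_add_one_right_iff).1 h3
  have hreg : IsRegularLocalRing (A ⧸ Ideal.span {x}) :=
    .of_spanFinrank_maximalIdeal_le _ (le_trans (by exact_mod_cast hle) hge)
  refine ⟨hreg, le_antisymm ?_ hge⟩
  rw [← IsRegularLocalRing.spanFinrank_maximalIdeal]
  exact_mod_cast hle

lemma not_maximalIdeal_le_sq [IsRegularLocalRing A] {d : ℕ}
    (hd : ringKrullDim A = (d + 1 : ℕ)) : ¬ maximalIdeal A ≤ maximalIdeal A ^ 2 := by
  intro h
  have h0 : maximalIdeal A = ⊥ := by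
    refine Submodule.eq_bot_of_le_smul_of_le_jacobson_bot (maximalIdeal A) _
      (IsNoetherian.noetherian _) (by rwa [smul_eq_mul, ← pow_two]) ?_
    exact IsLocalRing.maximalIdeal_le_jacobson _
  have := (IsLocalRing.isField_iff_maximalIdeal_eq).2 h0
  rw [ringKrullDim_eq_zero_of_isField this] at hd
  exact absurd hd (by norm_cast)

lemma isField_of_ringKrullDim_eq_zero [IsRegularLocalRing A] (hd : ringKrullDim A = (0 : ℕ)) :
    IsField A := by
  obtain ⟨v, hv⟩ := exists_span_range_eq_maximalIdeal hd
  rw [IsLocalRing.isField_iff_maximalIdeal_eq, ← hv]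
  simp [Set.range_eq_empty]

/-- Regular local rings are domains. Choose `x ∈ 𝔪 ∖ 𝔪²` outside all minimal primes; the quotient by
`x` is a domain by induction, so `(x)` contains a minimal prime `P`, and `P = xP` as `x ∉ P`. -/
lemma isDomain_of_isRegularLocalRing [IsRegularLocalRing A] {d : ℕ} (hd : ringKrullDim A = d) :
    IsDomain A := by
  induction d generalizing A with
  | zero => exact (isField_of_ringKrullDim_eq_zero hd).isDomain
  | succ d ih =>
    have hm : maximalIdeal A ∉ minimalPrimes A := fun h ↦ by
      rw [← Ideal.height_eq_zero_iff] at h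
      rw [← IsLocalRing.maximalIdeal_height_eq_ringKrullDim, h] at hd
      exact absurd hd (by norm_cast)
    -- The ideal `𝔪²`, which is not prime, is the exceptional member in prime avoidance.
    obtain ⟨x, hx, h⟩ := exists_mem_maximalIdeal_forall_notMem
      (S := insert (maximalIdeal A ^ 2) (minimalPrimes A))
      ((minimalPrimes.finite_of_isNoetherianRing A).insert _) (maximalIdeal A ^ 2)
      (fun p hp hne ↦ (hp.resolve_left hne).1.1) (by
        rintro p (rfl | hp)
        · exact not_maximalIdeal_le_sq hd
        · intro h
          exact hm ((maximalIdeal.isMaximal A).eq_of_le hp.1.1.ne_top h ▸ hp))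
    obtain ⟨_, hdim⟩ := isRegularLocalRing_quotient_span_singleton hd hx (h _ (.inl rfl))
    have := ih hdim
    have hprime : (Ideal.span {x}).IsPrime := (Ideal.Quotient.isDomain_iff_prime _).1 this
    obtain ⟨P, hP, hPx⟩ := Ideal.exists_minimalPrimes_le (I := ⊥) (J := Ideal.span {x}) bot_le
    have hxP : x ∉ P := h P (.inr hP)
    have : P = ⊥ := by
      refine Submodule.eq_bot_of_le_smul_of_le_jacobson_bot (maximalIdeal A) _
        (IsNoetherian.noetherian _) ?_ (IsLocalRing.maximalIdeal_le_jacobson _)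
      intro p hp
      obtain ⟨a, rfl⟩ := Ideal.mem_span_singleton.1 (hPx hp)
      exact Ideal.mul_mem_mul hx ((hP.1.1.mem_or_mem hp).resolve_left hxP)
    have : (⊥ : Ideal A).IsPrime := this ▸ hP.1.1
    exact IsDomain.of_bot_isPrime A

/-- The maximal ideal of a regular local ring is generated by a regular sequence. -/
lemma exists_isWeaklyRegular_ofList_eq_maximalIdeal [IsRegularLocalRing A] {d : ℕ}
    (hd : ringKrullDim A = d) :
    ∃ rs : List A, rs.length = d ∧ Ideal.ofList rs = maximalIdeal A ∧ IsWeaklyRegular A rs := by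
  induction d generalizing A with
  | zero =>
    refine ⟨[], rfl, ?_, .nil _ _⟩
    rw [Ideal.ofList_nil, eq_comm, ← IsLocalRing.isField_iff_maximalIdeal_eq]
    exact isField_of_ringKrullDim_eq_zero hd
  | succ d ih =>
    obtain ⟨x, hx, hx2⟩ := SetLike.not_le_iff_exists.1 (not_maximalIdeal_le_sq hd)
    obtain ⟨_, hdim⟩ := isRegularLocalRing_quotient_span_singleton hd hx hx2
    obtain ⟨ss, hlen, hss, hreg⟩ := ih hdim
    obtain ⟨rs, rfl⟩ := List.map_surjective_iff.2
      (Ideal.Quotient.mk_surjective (I := Ideal.span {x})) ss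
    have := isDomain_of_isRegularLocalRing hd
    have hx0 : x ≠ 0 := by rintro rfl; exact hx2 (zero_mem _)
    refine ⟨x :: rs, by simpa using hlen, ?_, .cons ?_ ?_⟩
    · rw [Ideal.ofList_cons]
      rw [maximalIdeal_quotient, ← Ideal.map_ofList] at hss
      have h1 := congrArg (Ideal.comap (Ideal.Quotient.mk (Ideal.span {x}))) hss
      rw [Ideal.comap_map_of_surjective _ Ideal.Quotient.mk_surjective,
        Ideal.comap_map_of_surjective _ Ideal.Quotient.mk_surjective,
        ← RingHom.ker_eq_comap_bot, Ideal.mk_ker] at h1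
      rw [sup_comm, h1, sup_eq_left]
      exact (Ideal.span_singleton_le_iff_mem _).2 hx
    · exact fun a b h ↦ mul_left_cancel₀ hx0 h
    · have h1 : IsWeaklyRegular (A ⧸ Ideal.span {x}) rs :=
        (isWeaklyRegular_map_algebraMap_iff (S := A ⧸ Ideal.span {x}) _ rs).1 hreg
      refine (LinearEquiv.isWeaklyRegular_congr (Submodule.quotEquivOfEq _ _ ?_) rs).1 h1
      rw [← Submodule.ideal_span_singleton_smul, smul_eq_mul, Ideal.mul_top]

/-- A finite module over a regular local ring of dimension `d` which admits a regular sequence of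
length `d` in the maximal ideal is free. -/
lemma free_of_isWeaklyRegular [IsRegularLocalRing A] {d : ℕ} (hd : ringKrullDim A = d)
    {M : Type*} [AddCommGroup M] [Module A M] [Module.Finite A M] {rs : List A}
    (hlen : rs.length = d) (hrs : ∀ r ∈ rs, r ∈ maximalIdeal A) (h : IsWeaklyRegular M rs) :
    Module.Free A M := by
  induction d generalizing A M with
  | zero =>
    let _ := (isField_of_ringKrullDim_eq_zero hd).toField
    infer_instance
  | succ d ih =>
    obtain ⟨x, hx, hxS⟩ := exists_mem_maximalIdeal_forall_notMem
      (S := insert (maximalIdeal A ^ 2) (associatedPrimes A M))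
      ((associatedPrimes.finite A M).insert _) (maximalIdeal A ^ 2)
      (fun p hp hne ↦ (hp.resolve_left hne).1) (by
        rintro p (rfl | hp)
        · exact not_maximalIdeal_le_sq hd
        · intro hle
          obtain _ | ⟨r, rs⟩ := rs
          · simp at hlen
          · exact (isSMulRegular_iff_forall_associatedPrimes r).1
              ((isWeaklyRegular_cons_iff M r rs).1 h).1 p hp (hle (hrs r (by simp))))
    have hxM : IsSMulRegular M x :=
      (isSMulRegular_iff_forall_associatedPrimes x).2 fun p hp ↦ hxS p (.inr hp)
    obtain ⟨ts, hts, htm, ht⟩ := exists_isWeaklyRegular_quotSMulTop d hlen hrs h hx hxM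
    obtain ⟨_, hdim⟩ := isRegularLocalRing_quotient_span_singleton hd hx (hxS _ (.inl rfl))
    have := Module.finitePresentation_of_finite A M
    rw [← Module.free_quotSMulTop_iff_free A M (IsLocalRing.maximalIdeal_le_jacobson _ hx) hxM]
    have : Module.Finite (A ⧸ Ideal.span {x}) (QuotSMulTop x M) :=
      Module.Finite.of_restrictScalars_finite A _ _
    refine ih hdim (rs := ts.map (algebraMap A (A ⧸ Ideal.span {x}))) (by simpa using hts) ?_
      ((isWeaklyRegular_map_algebraMap_iff (S := A ⧸ Ideal.span {x}) _ ts).2 ht)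
    intro r hr
    obtain ⟨t, ht, rfl⟩ := List.mem_map.1 hr
    rw [maximalIdeal_quotient]
    exact Ideal.mem_map_of_mem _ (htm t ht)

end RegularLocal

/-! ### Standard graded algebras -/

section GradedRing

variable {R₀ R : Type u} [CommRing R₀] [CommRing R] [Algebra R₀ R]
  {𝒜 : ℕ → Submodule R₀ R} [GradedAlgebra 𝒜]

namespace IsStandardGraded

lemma bijective_algebraMap_zero (hR : IsStandardGraded 𝒜) :
    Function.Bijective (algebraMap R₀ (𝒜 0)) := by
  refine ⟨fun r s h ↦ ?_, fun a ↦ ?_⟩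
  · obtain ⟨t, -, ht⟩ := hR.degree_zero _ (SetLike.algebraMap_mem_graded 𝒜 r)
    exact (ht r rfl).trans (ht s (congrArg Subtype.val h).symm).symm
  · obtain ⟨r, hr, -⟩ := hR.degree_zero a a.2
    exact ⟨r, Subtype.ext hr⟩

/-- The projection of `R` to its component of degree zero, which is identified with `R₀`. -/
noncomputable def augmentation (hR : IsStandardGraded 𝒜) : R →+* R₀ :=
  (RingEquiv.ofBijective _ hR.bijective_algebraMap_zero).symm.toRingHom.comp
    (GradedRing.projZeroRingHom' 𝒜)

lemma algebraMap_augmentation (hR : IsStandardGraded 𝒜) (a : R) :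
    algebraMap R₀ R (hR.augmentation a) = (DirectSum.decompose 𝒜 a 0 : R) :=
  congrArg Subtype.val
    ((RingEquiv.ofBijective _ hR.bijective_algebraMap_zero).apply_symm_apply
      (GradedRing.projZeroRingHom' 𝒜 a))

lemma injective_algebraMap (hR : IsStandardGraded 𝒜) : Function.Injective (algebraMap R₀ R) :=
  fun _ _ h ↦ hR.bijective_algebraMap_zero.1 (Subtype.ext h)

lemma augmentation_algebraMap (hR : IsStandardGraded 𝒜) (r : R₀) :
    hR.augmentation (algebraMap R₀ R r) = r :=
  hR.injective_algebraMap <| (hR.algebraMap_augmentation _).trans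
    (DirectSum.decompose_of_mem_same _ (SetLike.algebraMap_mem_graded 𝒜 r))

lemma augmentation_eq_zero_iff (hR : IsStandardGraded 𝒜) (a : R) :
    hR.augmentation a = 0 ↔ a ∈ GrMod.irr 𝒜 := by
  rw [GrMod.irr, HomogeneousIdeal.toIdeal_irrelevant, ← map_eq_zero_iff _ hR.injective_algebraMap,
    algebraMap_augmentation]
  rfl

lemma sub_algebraMap_augmentation_mem (hR : IsStandardGraded 𝒜) (a : R) :
    a - algebraMap R₀ R (hR.augmentation a) ∈ GrMod.irr 𝒜 := by
  rw [← hR.augmentation_eq_zero_iff, map_sub, augmentation_algebraMap, sub_self]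

/-- The augmentation identifies `R / (JR + R₊)` with `R₀ / J`. -/
lemma augmentation_mem (hR : IsStandardGraded 𝒜) (J : Ideal R₀) {a : R}
    (ha : a ∈ J.map (algebraMap R₀ R) ⊔ GrMod.irr 𝒜) : hR.augmentation a ∈ J := by
  change a ∈ J.comap hR.augmentation
  refine (sup_le (a := J.map (algebraMap R₀ R)) (b := GrMod.irr 𝒜)
    (Ideal.map_le_iff_le_comap.2 fun r hr ↦ ?_) fun a ha ↦ ?_ :
      _ ≤ J.comap hR.augmentation) ha
  · rwa [Ideal.mem_comap, Ideal.mem_comap, augmentation_algebraMap]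
  · rw [Ideal.mem_comap, (hR.augmentation_eq_zero_iff a).2 ha]
    exact zero_mem _

lemma algebraMap_mem_iff (hR : IsStandardGraded 𝒜) (J : Ideal R₀) (r : R₀) :
    algebraMap R₀ R r ∈ J.map (algebraMap R₀ R) ⊔ GrMod.irr 𝒜 ↔ r ∈ J :=
  ⟨fun h ↦ hR.augmentation_algebraMap r ▸ hR.augmentation_mem J h,
    fun h ↦ Ideal.mem_sup_left (Ideal.mem_map_of_mem _ h)⟩

/-- The components of a Noetherian graded ring are Noetherian over the component of degree zero,
as a submodule `N` of `𝒜 μ` is recovered from the ideal it generates as its part of degree `μ`. -/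
lemma isNoetherian_component (hR : IsStandardGraded 𝒜) [IsNoetherianRing R] (μ : ℕ) :
    IsNoetherian R₀ (𝒜 μ) := by
  let F (N : Submodule R₀ (𝒜 μ)) : Ideal R := Ideal.span ((↑) '' (N : Set (𝒜 μ)))
  have hF (N : Submodule R₀ (𝒜 μ)) (y : R) (hy : y ∈ F N) (a : R) :
      DirectSum.decompose 𝒜 (a * y) μ ∈ N := by
    induction hy using Submodule.span_induction generalizing a with
    | mem y hy =>
      obtain ⟨n, hn, rfl⟩ := hy
      have : DirectSum.decompose 𝒜 (a * n) μ = hR.augmentation a • n := Subtype.ext <| by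
        rw [Submodule.coe_smul, Algebra.smul_def, algebraMap_augmentation,
          ← DirectSum.coe_decompose_mul_add_of_right_mem 𝒜 n.2, zero_add]
      rw [this]
      exact N.smul_mem _ hn
    | zero => rw [mul_zero, DirectSum.decompose_zero]; exact N.zero_mem
    | add x y _ _ hx hy => rw [mul_add, DirectSum.decompose_add]; exact N.add_mem (hx a) (hy a)
    | smul b y _ hy => rw [smul_eq_mul, ← mul_assoc]; exact hy (a * b)
  have hmono : StrictMono F := by
    refine Monotone.strictMono_of_injective
      (fun N N' h ↦ Ideal.span_mono (Set.image_mono h)) fun N N' h ↦ ?_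
    have key (N N' : Submodule R₀ (𝒜 μ)) (h : F N = F N') : N ≤ N' := fun n hn ↦ by
      have := hF N' n (h ▸ Ideal.subset_span ⟨n, hn, rfl⟩) 1
      rwa [one_mul, DirectSum.decompose_coe, DirectSum.of_eq_same] at this
    exact le_antisymm (key _ _ h) (key _ _ h.symm)
  rw [isNoetherian_iff']
  exact hmono.wellFoundedGT

end IsStandardGraded

/-- Weak regularity of a sequence passes to direct summands. -/
lemma RingTheory.Sequence.IsWeaklyRegular.of_retract {A M N : Type*} [CommRing A] [AddCommGroup M]
    [Module A M] [AddCommGroup N] [Module A N] (i : N →ₗ[A] M) (p : M →ₗ[A] N)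
    (hpi : p ∘ₗ i = LinearMap.id) {rs : List A} (h : IsWeaklyRegular M rs) :
    IsWeaklyRegular N rs := by
  induction rs generalizing M N with
  | nil => exact .nil _ _
  | cons r rs ih =>
    obtain ⟨h1, h2⟩ := (isWeaklyRegular_cons_iff M r rs).1 h
    refine .cons (h1.of_injective i (LinearMap.injective_of_comp_eq_id i p hpi)) ?_
    refine ih (QuotSMulTop.map r i) (QuotSMulTop.map r p) ?_ h2
    rw [← QuotSMulTop.map_comp, hpi, QuotSMulTop.map_id]

/-- The components of `R` are direct summands of `R` over `R₀`. -/
lemma isWeaklyRegular_component (μ : ℕ) {rs : List R₀} (h : IsWeaklyRegular R rs) :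
    IsWeaklyRegular (𝒜 μ) rs := by
  refine h.of_retract (𝒜 μ).subtype
    ((DirectSum.component R₀ ℕ (fun i ↦ 𝒜 i) μ).comp
      (DirectSum.decomposeLinearEquiv 𝒜).toLinearMap) ?_
  ext x
  simp

/-- Over a regular local ring `R₀` of dimension `d`, the existence of an `R`-regular sequence of
length `d` in the maximal ideal of `R₀` is equivalent to freeness of the components of `R`. -/
lemma exists_isRegular_iff_free_component [IsRegularLocalRing R₀] [IsNoetherianRing R]
    (hR : IsStandardGraded 𝒜) {d : ℕ} (hd : ringKrullDim R₀ = d) :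
    (∃ rs : List R₀, rs.length = d ∧ (∀ r ∈ rs, r ∈ maximalIdeal R₀) ∧ IsRegular R rs) ↔
      ∀ μ : ℕ, Module.Free R₀ (𝒜 μ) := by
  refine ⟨fun ⟨rs, hlen, hrs, hreg⟩ μ ↦ ?_, fun h ↦ ?_⟩
  · have := hR.isNoetherian_component μ
    exact free_of_isWeaklyRegular hd hlen hrs (isWeaklyRegular_component μ hreg.1)
  · obtain ⟨rs, hlen, hspan, hreg⟩ := exists_isWeaklyRegular_ofList_eq_maximalIdeal hd
    have : Module.Free R₀ R := .of_equiv (DirectSum.decomposeLinearEquiv 𝒜).symm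
    refine ⟨rs, hlen, fun r hr ↦ hspan ▸ Ideal.subset_span hr, ?_, ?_⟩
    · exact (isWeaklyRegular_map_algebraMap_iff (S := R) R rs).1 (hreg.of_flat (S := R))
    · rw [hspan, Ideal.smul_top_eq_map]
      intro h
      have h1 : (1 : R) ∈ (maximalIdeal R₀).map (algebraMap R₀ R) := by
        have : (1 : R) ∈ (⊤ : Submodule R₀ R) := trivial
        rwa [h] at this
      have := hR.augmentation_mem _ (Ideal.mem_sup_left h1)
      rw [map_one] at this
      exact (Ideal.ne_top_iff_one _).1 (maximalIdeal.isMaximal R₀).ne_top this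

end GradedRing

/-! ### The category of graded modules -/

namespace GrMod

variable {R₀ R : Type u} [CommRing R₀] [CommRing R] [Algebra R₀ R] {𝒜 : ℕ → Submodule R₀ R}

lemma mono_of_injective {M N : GrMod 𝒜} (f : M ⟶ N) (hf : Function.Injective (toLin f)) :
    Mono f :=
  ⟨fun _ _ h ↦ hom_ext fun x ↦ hf (toLin_congr h x)⟩

lemma epi_of_surjective {M N : GrMod 𝒜} (f : M ⟶ N) (hf : Function.Surjective (toLin f)) :
    Epi f :=
  ⟨fun g g' h ↦ hom_ext fun y ↦ by
    obtain ⟨x, rfl⟩ := hf y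
    exact toLin_congr h x⟩

lemma isIso_of_bijective {M N : GrMod 𝒜} (f : M ⟶ N) (hf : Function.Bijective (toLin f)) :
    IsIso f :=
  have := mono_of_injective f hf.1
  have := epi_of_surjective f hf.2
  isIso_of_mono_of_epi f

/-- Short exactness in the category of graded modules can be checked on the underlying modules. -/
lemma shortExact_of_exact {M N P : GrMod 𝒜} (f : M ⟶ N) (g : N ⟶ P)
    (hf : Function.Injective (toLin f)) (hg : Function.Surjective (toLin g))
    (hfg : Function.Exact (toLin f) (toLin g)) :
    (ShortComplex.mk f g (hom_ext fun x ↦ hfg.apply_apply_eq_zero x)).ShortExact := by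
  have := mono_of_injective f hf
  have := epi_of_surjective g hg
  refine ShortComplex.ShortExact.mk (ShortComplex.exact_of_f_is_kernel _
    (KernelFork.IsLimit.ofι' _ _ fun {W} k hk ↦ ?_))
  let e := LinearEquiv.ofInjective (toLin f) hf
  have he (y) : toLin f (e.symm y) = y.1 := congrArg Subtype.val (e.apply_symm_apply y)
  have hr (x : W.carrier) : toLin k x ∈ LinearMap.range (toLin f) :=
    (hfg _).1 (toLin_congr hk x)
  refine ⟨ofLin (e.symm.toLinearMap.comp ((toLin k).codRestrict _ hr)) fun j x hx ↦
    mem_piece_of_injective f hf ?_, hom_ext fun _ ↦ he _⟩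
  rw [LinearMap.comp_apply, LinearEquiv.coe_coe, he]
  exact toLin_mem k hx

lemma mem_of_forall_mem_piece (M : GrMod 𝒜) (P : Submodule R M.carrier)
    (h : ∀ j, ∀ x ∈ M.piece j, x ∈ P) (x : M.carrier) : x ∈ P := by
  let _ := M.isInternal.chooseDecomposition
  induction x using DirectSum.Decomposition.inductionOn M.piece with
  | zero => exact P.zero_mem
  | @homogeneous i m => exact h i m m.2
  | add a b ha hb => exact P.add_mem ha hb

variable (𝒜) in
/-- The component of `R` of degree `j ∈ ℤ`, which is zero for negative `j`. -/
def ringPiece (j : ℤ) : Submodule R₀ R := if 0 ≤ j then 𝒜 j.toNat else ⊥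

lemma ringPiece_natCast (n : ℕ) : ringPiece 𝒜 n = 𝒜 n := by simp [ringPiece]

lemma ringPiece_of_neg {j : ℤ} (hj : j < 0) : ringPiece 𝒜 j = ⊥ := by simp [ringPiece, hj]

lemma smul_mem_of_mem_ringPiece (M : GrMod 𝒜) {i j : ℤ} {a : R} {x : M.carrier}
    (ha : a ∈ ringPiece 𝒜 i) (hx : x ∈ M.piece j) : a • x ∈ M.piece (i + j) := by
  unfold ringPiece at ha
  split_ifs at ha with hi
  · simpa [hi] using M.smul_mem ha hx
  · rw [(Submodule.mem_bot R₀).1 ha, zero_smul]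
    exact zero_mem _

/-- Graded modules are modules over `R₀` by restriction of scalars. -/
instance (M : GrMod 𝒜) : Module R₀ M.carrier := Module.compHom M.carrier (algebraMap R₀ R)

instance (M : GrMod 𝒜) : IsScalarTower R₀ R M.carrier := .of_algebraMap_smul fun _ _ ↦ rfl

variable [GradedAlgebra 𝒜]

/-- The components of a graded module, as modules over `R₀`. -/
def component (M : GrMod 𝒜) (j : ℤ) : Submodule R₀ M.carrier where
  __ := M.piece j
  smul_mem' r x hx := by
    have := M.smul_mem (SetLike.algebraMap_mem_graded 𝒜 r) hx
    rwa [Nat.cast_zero, zero_add, algebraMap_smul] at this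

@[simp] lemma mem_component {M : GrMod 𝒜} {j : ℤ} {x : M.carrier} :
    x ∈ M.component j ↔ x ∈ M.piece j := Iff.rfl

/-- The ring `R₀` acts on the category of graded `R`-modules. -/
noncomputable instance : Linear R₀ (GrMod 𝒜) where
  homModule _ N :=
    { smul r f := ofLin (r • toLin f) fun j _ hx ↦ (N.component j).smul_mem r (toLin_mem f hx)
      one_smul f := hom_ext fun x ↦ one_smul R₀ (toLin f x)
      mul_smul r s f := hom_ext fun x ↦ mul_smul r s (toLin f x)
      smul_zero r := hom_ext fun _ ↦ smul_zero (A := N.carrier) r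
      smul_add r f g := hom_ext fun x ↦ smul_add r (toLin f x) (toLin g x)
      add_smul r s f := hom_ext fun x ↦ add_smul r s (toLin f x)
      zero_smul f := hom_ext fun x ↦ zero_smul R₀ (toLin f x) }
  smul_comp _ _ _ r f g := hom_ext fun x ↦ LinearMap.map_smul_of_tower (toLin g) r (toLin f x)
  comp_smul _ _ _ _ _ _ := hom_ext fun _ ↦ rfl

/-! ### Graded free modules -/

variable (𝒜) in
/-- The projection of `R` to its component of degree `j ∈ ℤ`. -/
def ringProj (j : ℤ) : R →+ R :=
  if 0 ≤ j then (GradedRing.proj 𝒜 j.toNat) else 0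

lemma ringProj_mem (j : ℤ) (a : R) : ringProj 𝒜 j a ∈ ringPiece 𝒜 j := by
  unfold ringProj ringPiece
  split_ifs
  · exact SetLike.coe_mem _
  · exact zero_mem _

lemma ringProj_of_mem (i j : ℤ) {a : R} (ha : a ∈ ringPiece 𝒜 j) :
    ringProj 𝒜 i a = if j = i then a else 0 := by
  unfold ringPiece at ha
  unfold ringProj
  split_ifs at ha with hj
  · split_ifs with hi hij hij
    · subst hij
      exact DirectSum.decompose_of_mem_same _ ha
    · exact DirectSum.decompose_of_mem_ne _ ha (by omega)
    · omega
    · rfl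
  · rw [(Submodule.mem_bot R₀).1 ha]
    simp

lemma finite_ringProj (a : R) : {j | ringProj 𝒜 j a ≠ 0}.Finite := by
  classical
  refine ((DFinsupp.support (DirectSum.decompose 𝒜 a)).finite_toSet.image
    (Nat.cast : ℕ → ℤ)).subset fun j hj ↦ ?_
  by_cases h : 0 ≤ j
  · refine ⟨j.toNat, ?_, by simp [h]⟩
    simp only [Finset.mem_coe, DFinsupp.mem_support_toFun, ne_eq]
    intro h0
    apply hj
    rw [ringProj, if_pos h, GradedRing.proj_apply, h0]
    rfl
  · exact absurd (by simp [ringProj, h]) hj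

lemma eq_zero_of_ringProj {a : R} (h : ∀ j, ringProj 𝒜 j a = 0) : a = 0 := by
  apply (DirectSum.decompose 𝒜).injective
  rw [DirectSum.decompose_zero]
  ext n
  simpa [ringProj] using h n

lemma mul_mem_ringPiece {i : ℕ} {j : ℤ} {a b : R} (ha : a ∈ 𝒜 i) (hb : b ∈ ringPiece 𝒜 j) :
    a * b ∈ ringPiece 𝒜 (i + j) := by
  unfold ringPiece at hb
  split_ifs at hb with hj
  · lift j to ℕ using hj
    rw [← Nat.cast_add, ringPiece_natCast]
    exact SetLike.mul_mem_graded ha (by simpa using hb)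
  · rw [(Submodule.mem_bot R₀).1 hb, mul_zero]
    exact zero_mem _

variable (𝒜) in
/-- The graded free module `⨁ R(-deg i)` on a family of generators of degrees `deg i`. -/
noncomputable def free {ι : Type} (deg : ι → ℤ) : GrMod 𝒜 where
  carrier := ι →₀ R
  piece j :=
    { carrier := {f | ∀ i, f i ∈ ringPiece 𝒜 (j - deg i)}
      zero_mem' := fun _ ↦ zero_mem _
      add_mem' := fun hf hg i ↦ add_mem (hf i) (hg i)
      neg_mem' := fun hf i ↦ neg_mem (hf i) }
  isInternal := by
    let π (j : ℤ) : (ι →₀ R) →+ (ι →₀ R) :=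
      { toFun f := .onFinset f.support (fun i ↦ ringProj 𝒜 (j - deg i) (f i)) fun i hi ↦ by
          rw [Finsupp.mem_support_iff]
          intro h
          exact hi (by rw [h, map_zero])
        map_zero' := by ext i; simp
        map_add' f g := by ext i; simp }
    have hπ (j f i) : π j f i = ringProj 𝒜 (j - deg i) (f i) := rfl
    refine isInternal_of_proj _ π (fun j f i ↦ ringProj_mem _ _) (fun i j f hf ↦ ?_) (fun f ↦ ?_)
      (fun f hf ↦ ?_)
    · ext l
      rw [hπ, ringProj_of_mem _ _ (hf l)]
      by_cases h : j = i
      · simp [h]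
      · simp [h]
    · refine (f.support.finite_toSet.biUnion fun i _ ↦ (finite_ringProj (𝒜 := 𝒜) (f i)).preimage
        (sub_left_injective (b := deg i)).injOn).subset fun j hj ↦ ?_
      obtain ⟨i, hi⟩ := Finsupp.ne_iff.1 hj
      rw [hπ] at hi
      refine Set.mem_biUnion (x := i) ?_ hi
      rw [Finset.mem_coe, Finsupp.mem_support_iff]
      intro h
      exact hi (by rw [h, map_zero]; rfl)
    · ext i
      refine eq_zero_of_ringProj (𝒜 := 𝒜) fun j ↦ ?_
      have := DFunLike.congr_fun (hf (j + deg i)) i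
      rwa [hπ, add_sub_cancel_right] at this
  smul_mem := fun ha hx i ↦ by
    rw [add_sub_assoc]
    exact mul_mem_ringPiece ha (hx i)

section free

variable {ι : Type} {deg : ι → ℤ}

variable (𝒜 deg) in
/-- The generators of a graded free module. -/
noncomputable def freeGen (i : ι) : (free 𝒜 deg).carrier := (Finsupp.single i 1 : ι →₀ R)

lemma freeGen_mem (i : ι) : freeGen 𝒜 deg i ∈ (free 𝒜 deg).piece (deg i) := by
  classical
  intro l
  change (Finsupp.single i (1 : R)) l ∈ _
  rw [Finsupp.single_apply]
  split_ifs with h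
  · subst h
    rw [sub_self, ← Nat.cast_zero, ringPiece_natCast]
    exact SetLike.one_mem_graded 𝒜
  · exact zero_mem _

/-- The homomorphism from a graded free module given by the images of the generators. -/
noncomputable def freeLift (M : GrMod 𝒜) (x : ι → M.carrier) (hx : ∀ i, x i ∈ M.piece (deg i)) :
    free 𝒜 deg ⟶ M :=
  ofLin (Finsupp.linearCombination R x) fun j f hf ↦ by
    change Finsupp.sum f (fun i a ↦ a • x i) ∈ M.piece j
    refine sum_mem fun i _ ↦ ?_
    have := M.smul_mem_of_mem_ringPiece (hf i) (hx i)
    rwa [sub_add_cancel] at this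

lemma toLin_freeLift_freeGen {M : GrMod 𝒜} {x : ι → M.carrier} (hx : ∀ i, x i ∈ M.piece (deg i))
    (i : ι) : toLin (freeLift M x hx) (freeGen 𝒜 deg i) = x i :=
  (Finsupp.linearCombination_single R 1 i).trans (one_smul R _)

lemma free_hom_ext {M : GrMod 𝒜} {f g : free 𝒜 deg ⟶ M}
    (h : ∀ i, toLin f (freeGen 𝒜 deg i) = toLin g (freeGen 𝒜 deg i)) : f = g :=
  Subtype.ext <| Finsupp.lhom_ext' fun i ↦ LinearMap.ext_ring (h i)

/-- Graded free modules are projective: the generators lift to homogeneous elements. -/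
instance : Projective (free 𝒜 deg) where
  factors {M N} f g _ := by
    choose x hx hgx using fun i ↦ exists_mem_piece_of_surjective g (surjective_of_epi g)
      (toLin_mem f (freeGen_mem (𝒜 := 𝒜) (deg := deg) i))
    refine ⟨freeLift M x hx, free_hom_ext fun i ↦ ?_⟩
    rw [toLin_comp, LinearMap.comp_apply, toLin_freeLift_freeGen, hgx]

lemma piece_free_eq_bot {a : ℤ} (ha : ∀ i, a ≤ deg i) {j : ℤ} (hj : j < a) :
    (free 𝒜 deg).piece j = ⊥ := by
  refine (AddSubgroup.eq_bot_iff_forall _).2 fun f hf ↦ Finsupp.ext fun i ↦ ?_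
  have := hf i
  rw [ringPiece_of_neg (by linarith [ha i])] at this
  exact this

/-- A component of a graded free module is the product of finitely many components of `R`. -/
noncomputable def componentFreeEquiv (j : ℤ) (hfin : {i | deg i ≤ j}.Finite) :
    (free 𝒜 deg).component j ≃ₗ[R₀] ((i : {i // deg i ≤ j}) → ringPiece 𝒜 (j - deg i)) :=
  let ev (i : ι) : (free 𝒜 deg).carrier → R := fun f ↦ DFunLike.coe (F := ι →₀ R) f i
  let φ : (free 𝒜 deg).component j →ₗ[R₀] ((i : {i // deg i ≤ j}) → ringPiece 𝒜 (j - deg i)) :=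
    { toFun f i := ⟨ev i f.1, f.2 i⟩
      map_add' _ _ := rfl
      map_smul' r f := funext fun i ↦ Subtype.ext (Algebra.smul_def r (ev i f.1)).symm }
  have hφ (f i) : ev i.1 f.1 = (φ f i : R) := rfl
  .ofBijective φ <| by
    classical
    constructor
    · intro f g hfg
      refine Subtype.ext (Finsupp.ext fun i ↦ ?_)
      by_cases hi : deg i ≤ j
      · exact (hφ f ⟨i, hi⟩).trans (congrArg Subtype.val (congrFun hfg ⟨i, hi⟩))
      · have h1 := f.2 i
        have h2 := g.2 i
        rw [ringPiece_of_neg (by linarith), Submodule.mem_bot] at h1 h2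
        exact h1.trans h2.symm
    · intro v
      let f : ι →₀ R := Finsupp.onFinset hfin.toFinset
        (fun i ↦ if hi : deg i ≤ j then (v ⟨i, hi⟩ : R) else 0) fun i hi ↦ by
          by_contra h
          exact hi (dif_neg (by simpa using h))
      have hf (i) : f i = if hi : deg i ≤ j then (v ⟨i, hi⟩ : R) else 0 := rfl
      refine ⟨⟨f, fun i ↦ ?_⟩, ?_⟩
      · rw [hf]
        split_ifs with hi
        · exact (v ⟨i, hi⟩).2
        · exact zero_mem _
      · ext i
        exact (hφ _ i).symm.trans ((hf i).trans (dif_pos i.2))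

end free

/-! ### Covers of modules with free components -/

/-- All components are free of finite rank over `R₀`. -/
def HasFreeComponents (M : GrMod 𝒜) : Prop :=
  ∀ j, Module.Free R₀ (M.component j) ∧ Module.Finite R₀ (M.component j)

lemma hasFreeComponents_free (h : ∀ n, Module.Free R₀ (𝒜 n) ∧ Module.Finite R₀ (𝒜 n))
    {ι : Type} {deg : ι → ℤ} (hfin : ∀ j, {i | deg i ≤ j}.Finite) :
    (free 𝒜 deg).HasFreeComponents := fun j ↦ by
  have h1 (j : ℤ) : Module.Free R₀ (ringPiece 𝒜 j) ∧ Module.Finite R₀ (ringPiece 𝒜 j) := by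
    rcases lt_or_ge j 0 with hj | hj
    · rw [ringPiece_of_neg hj]
      exact ⟨inferInstance, inferInstance⟩
    · lift j to ℕ using hj
      rw [ringPiece_natCast]
      exact h j
  have := fun j ↦ (h1 j).1
  have := fun j ↦ (h1 j).2
  have : Finite {i // deg i ≤ j} := hfin j
  let e := componentFreeEquiv (𝒜 := 𝒜) j (hfin j)
  exact ⟨.of_equiv e.symm, .equiv e.symm⟩

/-- The restriction of a homomorphism to the components of one degree. -/
def componentMap {M N : GrMod 𝒜} (f : M ⟶ N) (j : ℤ) : M.component j →ₗ[R₀] N.component j :=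
  ((toLin f).restrictScalars R₀).restrict fun _ hx ↦ toLin_mem f hx

/-- The surjection splits, so its kernel is projective; finite projective modules over local rings
are free. -/
lemma free_finite_ker {A : Type*} [CommRing A] [IsLocalRing A] [IsNoetherianRing A]
    {P Q : Type*} [AddCommGroup P] [AddCommGroup Q] [Module A P] [Module A Q]
    [Module.Finite A P] [Module.Free A P] [Module.Free A Q] (f : P →ₗ[A] Q)
    (hf : Function.Surjective f) :
    Module.Free A (LinearMap.ker f) ∧ Module.Finite A (LinearMap.ker f) := by
  obtain ⟨s, hs⟩ := Module.projective_lifting_property f LinearMap.id hf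
  have hs (x) : f (s x) = x := LinearMap.congr_fun hs x
  have : Module.Projective A (LinearMap.ker f) :=
    .of_split (LinearMap.ker f).subtype
      ((LinearMap.id - s ∘ₗ f).codRestrict _ fun x ↦ by simp [hs]) (by ext x; simp)
  exact ⟨Module.free_of_flat_of_isLocalRing, inferInstance⟩

/-- The kernel of an epimorphism. -/
abbrev kernelObj {M N : GrMod 𝒜} (f : M ⟶ N) : GrMod 𝒜 := M.sub _ (isHomog_ker f)

lemma HasFreeComponents.kernelObj [IsLocalRing R₀] [IsNoetherianRing R₀] {M N : GrMod 𝒜}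
    (hM : M.HasFreeComponents) (hN : N.HasFreeComponents) (f : M ⟶ N)
    (hf : Function.Surjective (toLin f)) : (kernelObj f).HasFreeComponents := fun j ↦ by
  have := (hM j).1
  have := (hM j).2
  have := (hN j).1
  have h := free_finite_ker (componentMap f j) fun y ↦ by
    obtain ⟨x, hx, hxy⟩ := exists_mem_piece_of_surjective f hf y.2
    exact ⟨⟨x, hx⟩, Subtype.ext hxy⟩
  let e : LinearMap.ker (componentMap f j) ≃ₗ[R₀] (GrMod.kernelObj f).component j :=
    { toFun x := ⟨⟨x.1.1, congrArg Subtype.val x.2⟩, x.1.2⟩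
      invFun x := ⟨⟨x.1.1, x.2⟩, Subtype.ext x.1.2⟩
      map_add' _ _ := rfl
      map_smul' _ _ := rfl
      left_inv _ := rfl
      right_inv _ := rfl }
  have := h.1
  have := h.2
  exact ⟨.of_equiv e, .equiv e⟩

/-- A module with free components in degrees `≥ a` is a quotient of a graded free module of the
same kind by a submodule living in degrees `≥ a + 1`: take homogeneous bases of all components as
generators. -/
lemma exists_free_cover [Nontrivial R₀] (hR : IsStandardGraded 𝒜)
    (h : ∀ n, Module.Free R₀ (𝒜 n) ∧ Module.Finite R₀ (𝒜 n)) {M : GrMod 𝒜}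
    (hM : M.HasFreeComponents) {a : ℤ} (ha : ∀ j < a, M.piece j = ⊥) :
    ∃ (F : GrMod 𝒜) (π : F ⟶ M), Projective F ∧ F.HasFreeComponents ∧
      Function.Surjective (toLin π) ∧ ∀ j < a + 1, (kernelObj π).piece j = ⊥ := by
  have := fun j ↦ (hM j).1
  have := fun j ↦ (hM j).2
  let ι := Σ j : ℤ, Fin (Module.finrank R₀ (M.component j))
  let deg : ι → ℤ := Sigma.fst
  let b (j : ℤ) := Module.finBasis R₀ (M.component j)
  let x (i : ι) : M.carrier := b i.1 i.2
  have hx (i : ι) : x i ∈ M.piece (deg i) := (b i.1 i.2).2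
  -- Components of degree `< a` are zero, hence contribute no generators.
  have hdeg (i : ι) : a ≤ deg i := by
    by_contra! hlt
    have : M.component i.1 = ⊥ := by
      ext y
      rw [mem_component, ha _ hlt]
      rfl
    have : Module.finrank R₀ (M.component i.1) = 0 := by rw [this]; exact finrank_bot _ _
    exact (Fin.cast this i.2).elim0
  have hfin (j : ℤ) : {i : ι | deg i ≤ j}.Finite := by
    have : {i : ι | deg i ≤ j} ⊆ ⋃ l ∈ Set.Icc a j, Set.range (Sigma.mk l) := fun i hi ↦
      Set.mem_biUnion ⟨hdeg i, hi⟩ ⟨i.2, rfl⟩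
    exact ((Set.finite_Icc a j).biUnion fun _ _ ↦ Set.finite_range _).subset this
  refine ⟨free 𝒜 deg, freeLift M x hx, inferInstance, hasFreeComponents_free h hfin,
    fun y ↦ ?_, fun j hj ↦ ?_⟩
  · -- The image contains a basis of every component.
    rw [← LinearMap.mem_range]
    refine M.mem_of_forall_mem_piece _ (fun j y hy ↦ ?_) y
    have h1 := congrArg Subtype.val ((b j).sum_repr ⟨y, hy⟩)
    rw [AddSubmonoidClass.coe_finsetSum] at h1
    rw [show y = _ from h1.symm]
    refine sum_mem fun k _ ↦ ?_
    rw [Submodule.coe_smul, ← algebraMap_smul R]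
    exact Submodule.smul_mem _ _ ⟨freeGen 𝒜 deg ⟨j, k⟩, toLin_freeLift_freeGen hx ⟨j, k⟩⟩
  · refine (AddSubgroup.eq_bot_iff_forall _).2 fun ⟨f, hf⟩ hfj ↦ Subtype.ext ?_
    change f ∈ (free 𝒜 deg).piece j at hfj
    rcases (Int.lt_add_one_iff.1 hj).lt_or_eq with hj | rfl
    · rw [piece_free_eq_bot hdeg hj] at hfj
      exact hfj
    · -- In degree `j` the cover is the isomorphism given by the basis of the component of `M`.
      let f' : ι →₀ R := f
      let c (k) : R₀ := hR.augmentation (f' ⟨j, k⟩)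
      have hf' : f' = ∑ k, Finsupp.single (⟨j, k⟩ : ι) (algebraMap R₀ R (c k)) := by
        classical
        ext ⟨l, k⟩
        have hl : f' ⟨l, k⟩ ∈ ringPiece 𝒜 (j - l) := hfj ⟨l, k⟩
        rw [Finsupp.finsetSum_apply]
        by_cases hlj : l = j
        · subst hlj
          rw [Finset.sum_eq_single k (fun k' _ hk ↦ Finsupp.single_eq_of_ne (by simpa using hk.symm))
            (by simp), Finsupp.single_eq_same, hR.algebraMap_augmentation]
          rw [sub_self, ← Nat.cast_zero, ringPiece_natCast] at hl
          exact (DirectSum.decompose_of_mem_same _ hl).symm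
        · rw [Finset.sum_eq_zero fun k' _ ↦
            Finsupp.single_eq_of_ne fun h ↦ hlj (congrArg Sigma.fst h)]
          rw [ringPiece_of_neg (by have : j ≤ l := hdeg ⟨l, k⟩; omega)] at hl
          exact hl
      have h0 : Finsupp.linearCombination R x f' = 0 := hf
      have h1 : ∑ k, c k • b j k = 0 := Subtype.ext <| by
        rw [hf', map_sum] at h0
        rw [AddSubmonoidClass.coe_finsetSum]
        refine (Finset.sum_congr rfl fun k _ ↦ ?_).trans h0
        rw [Finsupp.linearCombination_single, algebraMap_smul]
        rfl
      have h2 := Fintype.linearIndependent_iff.1 (b j).linearIndependent c h1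
      change f' = 0
      rw [hf']
      simp [h2]

end GrMod

/-! ### Generalized local cohomology of modules killed by `R₊` -/

namespace GrMod

variable {R₀ R : Type u} [CommRing R₀] [CommRing R] [Algebra R₀ R] {𝒜 : ℕ → Submodule R₀ R}

section LocalCohomology

lemma bijective_mkQ_of_eq_bot {M : GrMod 𝒜} {P : Submodule R M.carrier} (hP : P = ⊥) :
    Function.Bijective P.mkQ := by
  subst hP
  exact ⟨LinearMap.ker_eq_bot.1 (Submodule.ker_mkQ _), Submodule.mkQ_surjective _⟩

variable [GradedAlgebra 𝒜]

lemma irr_pow_smul_top_eq_bot {M : GrMod 𝒜} (hM : ∀ a ∈ irr 𝒜, ∀ x : M.carrier, a • x = 0)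
    {n : ℕ} (hn : 1 ≤ n) : irr 𝒜 ^ n • (⊤ : Submodule R M.carrier) = ⊥ := by
  refine (Submodule.eq_bot_iff _).2 fun x hx ↦ ?_
  have hx := Submodule.smul_mono_left (Ideal.pow_le_self (I := irr 𝒜) (by omega : n ≠ 0)) hx
  exact Submodule.smul_induction_on hx (fun a ha x _ ↦ hM a ha x)
    fun x y hx hy ↦ by rw [hx, hy, add_zero]

lemma isIso_tower_map {M : GrMod 𝒜} (hM : ∀ a ∈ irr 𝒜, ∀ x : M.carrier, a • x = 0)
    {n : ℕ} (f : 1 ⟶ n) : IsIso (M.tower.map f.op) := by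
  have h1 := bijective_mkQ_of_eq_bot (irr_pow_smul_top_eq_bot hM le_rfl)
  have hn := bijective_mkQ_of_eq_bot (irr_pow_smul_top_eq_bot hM (leOfHom f))
  exact isIso_of_bijective _
    ((Function.Bijective.of_comp_iff (toLin (M.tower.map f.op)) hn).1 h1)

/-- If `R₊M = 0`, then the generalized local cohomology of `M` and `N` is `Ext (M, N)`, the direct
system being constant from `n = 1` on. -/
lemma nontrivial_genLocalCohomology_iff {M : GrMod 𝒜}
    (hM : ∀ a ∈ irr 𝒜, ∀ x : M.carrier, a • x = 0) (N : GrMod 𝒜) (i : ℕ) (μ : ℤ) :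
    Nontrivial (genLocalCohomology M N i μ) ↔ Nontrivial (Abelian.Ext M (N.shift μ) i) := by
  let E := (Abelian.extFunctor i).flip.obj (N.shift μ)
  have hconst : (M.tower.rightOp ⋙ E).IsEventuallyConstantFrom 1 := fun n f ↦ by
    have := isIso_tower_map hM f
    have : IsIso (M.tower.rightOp.map f) := inferInstanceAs (IsIso (M.tower.map f.op).op)
    exact inferInstanceAs (IsIso (E.map (M.tower.rightOp.map f)))
  have := hconst.isIso_ι_of_isColimit (colimit.isColimit _)
  have : IsIso (M.quotπ _ (M.isHomog_irr_pow 1)) :=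
    isIso_of_bijective _ (bijective_mkQ_of_eq_bot (irr_pow_smul_top_eq_bot hM le_rfl))
  let e : genLocalCohomology M N i μ ≅ E.obj (Opposite.op M) :=
    (asIso ((colimit.cocone (M.tower.rightOp ⋙ E)).ι.app 1)).symm ≪≫
      E.mapIso (asIso (M.quotπ _ (M.isHomog_irr_pow 1))).op
  exact e.addCommGroupIsoToAddEquiv.toEquiv.nontrivial_congr

end LocalCohomology

/-! ### Vanishing of extensions -/

section Vanishing

variable [GradedAlgebra 𝒜]

/-- If `M` has free components in degrees `≥ a`, and so does `R`, then `Extⁱ (M, N(μ)) = 0` for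
`i + μ + a > 0` and `N` concentrated in degree zero: by dimension shifting along the free covers,
which raises `a` by one each time. -/
lemma ext_eq_zero_of_hasFreeComponents [IsLocalRing R₀] [IsNoetherianRing R₀]
    (hR : IsStandardGraded 𝒜) (h : ∀ n, Module.Free R₀ (𝒜 n) ∧ Module.Finite R₀ (𝒜 n))
    {N : GrMod 𝒜} (hN : ∀ j ≠ 0, N.piece j = ⊥) {M : GrMod 𝒜} (hM : M.HasFreeComponents)
    {a : ℤ} (ha : ∀ j < a, M.piece j = ⊥) {i : ℕ} {μ : ℤ} (hi : 0 < i + μ + a)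
    (x : Abelian.Ext M (N.shift μ) i) : x = 0 := by
  induction i generalizing M a with
  | zero =>
    obtain ⟨f, rfl⟩ := Abelian.Ext.addEquiv₀.symm.surjective x
    suffices f = 0 by rw [this, map_zero]
    refine hom_ext fun m ↦ LinearMap.mem_ker.1 (M.mem_of_forall_mem_piece _ (fun j m hm ↦ ?_) m)
    rcases lt_or_ge j a with hj | hj
    · rw [ha j hj] at hm
      rw [show m = 0 from hm]
      exact zero_mem _
    · have : toLin f m ∈ N.piece (j + μ) := toLin_mem f hm
      rw [hN _ (by push_cast at hi; omega)] at this
      exact this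
  | succ i ih =>
    obtain ⟨F, π, _, hF, hπ, hK⟩ := exists_free_cover hR h hM ha
    have hS := shortExact_of_exact ((F.subι _ (isHomog_ker π))) π
      (Submodule.injective_subtype _) hπ (LinearMap.exact_subtype_ker_map (toLin π))
    obtain ⟨y, rfl⟩ := Abelian.Ext.contravariant_sequence_exact₃ hS _ x
      (Abelian.Ext.eq_zero_of_projective _) (add_comm 1 i)
    rw [ih (hF.kernelObj hM π hπ) hK (by push_cast at hi; omega) y, Abelian.Ext.comp_zero]

variable (𝒜) in
/-- The graded module `R₀/J`, concentrated in degree zero, as a quotient of `R`. -/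
def baseQuot (J : Ideal R₀) : GrMod 𝒜 :=
  concentrated (R ⧸ J.map (algebraMap R₀ R) ⊔ irr 𝒜) fun i hi a ha x ↦ by
    obtain ⟨x, rfl⟩ := Ideal.Quotient.mk_surjective x
    rw [Algebra.smul_def, Ideal.Quotient.algebraMap_eq, ← map_mul, Ideal.Quotient.eq_zero_iff_mem]
    refine Ideal.mul_mem_right _ _ (Ideal.mem_sup_right ?_)
    exact HomogeneousIdeal.mem_irrelevant_of_mem 𝒜 hi ha

lemma baseQuot_maximalIdeal [IsLocalRing R₀] :
    baseQuot 𝒜 (maximalIdeal R₀) = residueField 𝒜 := rfl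

lemma piece_baseQuot (J : Ideal R₀) (j : ℤ) :
    (baseQuot 𝒜 J).piece j = if j = 0 then ⊤ else ⊥ := rfl

lemma piece_baseQuot_of_ne (J : Ideal R₀) {j : ℤ} (hj : j ≠ 0) : (baseQuot 𝒜 J).piece j = ⊥ :=
  if_neg hj

variable (𝒜) in
/-- The map `R₀ → R₀/J`. -/
def baseMk (J : Ideal R₀) : R₀ →ₗ[R₀] (baseQuot 𝒜 J).carrier where
  toFun r := Submodule.Quotient.mk (algebraMap R₀ R r)
  map_add' r s := by rw [map_add]; rfl
  map_smul' r s := by rw [smul_eq_mul, map_mul]; rfl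

lemma baseMk_surjective (hR : IsStandardGraded 𝒜) (J : Ideal R₀) :
    Function.Surjective (baseMk 𝒜 J) := fun y ↦ by
  obtain ⟨a, rfl⟩ := Submodule.Quotient.mk_surjective _ y
  refine ⟨hR.augmentation a, Eq.symm ((Submodule.Quotient.eq _).2 ?_)⟩
  exact Ideal.mem_sup_right (hR.sub_algebraMap_augmentation_mem a)

lemma baseMk_eq_zero_iff (hR : IsStandardGraded 𝒜) (J : Ideal R₀) (r : R₀) :
    baseMk 𝒜 J r = 0 ↔ r ∈ J :=
  (Submodule.Quotient.mk_eq_zero _).trans (hR.algebraMap_mem_iff J r)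

/-- The projection `R₀/J → R₀/J'`. -/
def baseQuotMap {J J' : Ideal R₀} (h : J ≤ J') : baseQuot 𝒜 J ⟶ baseQuot 𝒜 J' :=
  ofLin (Submodule.factor (sup_le_sup_right (Ideal.map_mono h) _)) fun j x hx ↦ by
    rw [piece_baseQuot] at hx ⊢
    split_ifs at hx ⊢
    · trivial
    · rw [show x = 0 from hx]
      rfl

lemma baseQuotMap_baseMk {J J' : Ideal R₀} (h : J ≤ J') (r : R₀) :
    toLin (baseQuotMap (𝒜 := 𝒜) h) (baseMk 𝒜 J r) = baseMk 𝒜 J' r := rfl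

lemma hasFreeComponents_baseQuot_bot (hR : IsStandardGraded 𝒜) :
    (baseQuot 𝒜 (⊥ : Ideal R₀)).HasFreeComponents := fun j ↦ by
  by_cases hj : j = 0
  · have hmem (r : R₀) : baseMk 𝒜 ⊥ r ∈ (baseQuot 𝒜 (⊥ : Ideal R₀)).component j := by
      rw [mem_component, piece_baseQuot, if_pos hj]
      trivial
    let e : R₀ ≃ₗ[R₀] (baseQuot 𝒜 (⊥ : Ideal R₀)).component j :=
      .ofBijective ((baseMk 𝒜 ⊥).codRestrict _ hmem) <| by
        refine ⟨fun r s hrs ↦ ?_, fun y ↦ ?_⟩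
        · have := congrArg Subtype.val hrs
          change baseMk 𝒜 ⊥ r = baseMk 𝒜 ⊥ s at this
          rwa [← sub_eq_zero, ← map_sub, baseMk_eq_zero_iff hR, Ideal.mem_bot, sub_eq_zero] at this
        · obtain ⟨r, hr⟩ := baseMk_surjective hR ⊥ y.1
          exact ⟨r, Subtype.ext hr⟩
    exact ⟨.of_equiv e, .equiv e⟩
  · have : (baseQuot 𝒜 (⊥ : Ideal R₀)).component j = ⊥ := by
      ext y
      rw [mem_component, piece_baseQuot_of_ne _ hj]
      rfl
    rw [this]
    exact ⟨inferInstance, inferInstance⟩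

/-- The exact sequence `0 → R₀/J → R₀/J → R₀/(J + (x)) → 0` given by multiplication by an element
`x` regular on `R₀/J`. -/
lemma shortExact_baseQuot (hR : IsStandardGraded 𝒜) {J J' : Ideal R₀} {x : R₀}
    (hJ' : J' = J ⊔ Ideal.span {x}) (hle : J ≤ J') (hx : ∀ y, x * y ∈ J → y ∈ J) :
    ∃ h, (ShortComplex.mk (x • 𝟙 (baseQuot 𝒜 J)) (baseQuotMap hle) h).ShortExact := by
  have hsmul (r : R₀) : toLin (x • 𝟙 (baseQuot 𝒜 J)) (baseMk 𝒜 J r) = baseMk 𝒜 J (x * r) := by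
    rw [← smul_eq_mul, map_smul]
    rfl
  refine ⟨_, shortExact_of_exact _ _ ?_ (fun y ↦ ?_) fun y ↦ ?_⟩
  · rw [injective_iff_map_eq_zero]
    intro y hy
    obtain ⟨r, rfl⟩ := baseMk_surjective hR J y
    rw [hsmul, baseMk_eq_zero_iff hR] at hy
    exact (baseMk_eq_zero_iff hR J r).2 (hx r hy)
  · obtain ⟨r, rfl⟩ := baseMk_surjective hR J' y
    exact ⟨_, baseQuotMap_baseMk hle r⟩
  · obtain ⟨r, rfl⟩ := baseMk_surjective hR J y
    rw [baseQuotMap_baseMk, baseMk_eq_zero_iff hR, hJ']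
    constructor
    · intro hr
      obtain ⟨s, hs, t, ht, rfl⟩ := Submodule.mem_sup.1 hr
      obtain ⟨t, rfl⟩ := Ideal.mem_span_singleton.1 ht
      refine ⟨baseMk 𝒜 J t, ?_⟩
      rw [hsmul, map_add, (baseMk_eq_zero_iff hR J s).2 hs, zero_add]
    · rintro ⟨y, hy⟩
      obtain ⟨t, rfl⟩ := baseMk_surjective hR J y
      rw [hsmul, ← sub_eq_zero, ← map_sub, baseMk_eq_zero_iff hR] at hy
      have hxt : x * t ∈ J ⊔ Ideal.span {x} :=
        Ideal.mem_sup_right (Ideal.mem_span_singleton.2 ⟨t, rfl⟩)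
      have := sub_mem hxt (Ideal.mem_sup_left hy)
      rwa [sub_sub_cancel] at this

/-- Part of the long exact sequence: `Extⁱ (X₃, Y)` vanishes if `Extⁱ (X₂, Y)` and `Extⁱ⁻¹ (X₁, Y)`
do. -/
lemma ext_eq_zero_of_shortExact {C : Type*} [Category C] [Abelian C] [HasExt C]
    {S : ShortComplex C} (hS : S.ShortExact) {Y : C} {i : ℕ}
    (h₂ : ∀ y : Abelian.Ext S.X₂ Y i, y = 0)
    (h₁ : ∀ n, n + 1 = i → ∀ y : Abelian.Ext S.X₁ Y n, y = 0) (x : Abelian.Ext S.X₃ Y i) :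
    x = 0 := by
  cases i with
  | zero =>
    have := hS.epi_g
    exact Abelian.Ext.precomp_mk₀_injective_of_epi Y S.g ((h₂ _).trans (h₂ _).symm)
  | succ n =>
    obtain ⟨y, rfl⟩ := Abelian.Ext.contravariant_sequence_exact₃ hS _ x (h₂ _) (add_comm 1 n)
    rw [h₁ n rfl y, Abelian.Ext.comp_zero]

/-- If `r` is zero on `Y`, the connecting map of `0 → X -r→ X → Z → 0` is injective on
`Ext (-, Y)`. -/
lemma nontrivial_ext_of_shortExact_smul {A : Type*} [CommRing A] {C : Type*} [Category C]
    [Abelian C] [Linear A C] [HasExt C] {X Z Y : C} {r : A} {g : X ⟶ Z} {h : (r • 𝟙 X) ≫ g = 0}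
    (hS : (ShortComplex.mk (r • 𝟙 X) g h).ShortExact) (hr : r • 𝟙 Y = 0) {i : ℕ}
    (hX : Nontrivial (Abelian.Ext X Y i)) : Nontrivial (Abelian.Ext Z Y (i + 1)) := by
  obtain ⟨e, he⟩ := exists_ne (0 : Abelian.Ext X Y i)
  refine nontrivial_of_ne (hS.extClass.comp e (add_comm 1 i)) 0 fun h0 ↦ he ?_
  obtain ⟨y, rfl⟩ := Abelian.Ext.contravariant_sequence_exact₁ hS _ e (add_comm 1 i) h0
  -- Multiplication by `r` on `Ext (X, Y)` is induced by both `r • 𝟙 X` and `r • 𝟙 Y`.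
  change (Abelian.Ext.mk₀ (r • 𝟙 X)).comp y _ = 0
  rw [Abelian.Ext.mk₀_smul, Abelian.Ext.smul_comp, Abelian.Ext.mk₀_id_comp,
    Abelian.Ext.smul_eq_comp_mk₀, hr, Abelian.Ext.mk₀_zero, Abelian.Ext.comp_zero]

variable [IsLocalRing R₀]

lemma smul_id_shift_residueField_eq_zero {r : R₀} (hr : r ∈ maximalIdeal R₀) (μ : ℤ) :
    r • 𝟙 ((residueField 𝒜).shift μ) = 0 := hom_ext fun x ↦ by
  obtain ⟨a, rfl⟩ := Submodule.Quotient.mk_surjective _ x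
  refine (Submodule.Quotient.mk_eq_zero _).2 (Ideal.mem_sup_left ?_)
  exact Ideal.mul_mem_right _ _ (Ideal.mem_map_of_mem _ hr)

lemma nontrivial_ext_zero_baseQuot (hR : IsStandardGraded 𝒜) :
    Nontrivial (Abelian.Ext (baseQuot 𝒜 ⊥) ((residueField 𝒜).shift 0) 0) := by
  let g : baseQuot 𝒜 ⊥ ⟶ residueField 𝒜 := baseQuotMap (bot_le (a := maximalIdeal R₀))
  let φ : (baseQuot 𝒜 (⊥ : Ideal R₀)).carrier →ₗ[R] (residueField 𝒜).carrier := toLin g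
  let f : baseQuot 𝒜 ⊥ ⟶ (residueField 𝒜).shift 0 := ofLin φ fun j x hx ↦ by
    have : φ x ∈ (residueField 𝒜).piece (j + 0) := by
      rw [add_zero]
      exact toLin_mem g hx
    exact this
  refine nontrivial_of_ne (Abelian.Ext.addEquiv₀.symm f) 0 fun h ↦ ?_
  rw [map_eq_zero_iff _ (AddEquiv.injective _)] at h
  have h1 : baseMk 𝒜 (maximalIdeal R₀) 1 = 0 := toLin_congr h (baseMk 𝒜 ⊥ 1)
  rw [baseMk_eq_zero_iff hR] at h1
  exact (Ideal.ne_top_iff_one _).1 (maximalIdeal.isMaximal R₀).ne_top h1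

/-- For a regular sequence `r₁, r₂, …` in the maximal ideal, the groups
`Extⁱ (R₀/(r₁, …, rₙ), k(μ))` vanish for `i + μ > n`, and `Extⁿ (R₀/(r₁, …, rₙ), k) ≠ 0`. -/
lemma ext_baseQuot_take [IsNoetherianRing R₀] (hR : IsStandardGraded 𝒜)
    (h : ∀ n, Module.Free R₀ (𝒜 n) ∧ Module.Finite R₀ (𝒜 n)) {rs : List R₀}
    (hrs : ∀ r ∈ rs, r ∈ maximalIdeal R₀) (hreg : IsWeaklyRegular R₀ rs)
    {n : ℕ} (hn : n ≤ rs.length) :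
    (∀ (i : ℕ) (μ : ℤ), n < i + μ →
      ∀ e : Abelian.Ext (baseQuot 𝒜 (Ideal.ofList (rs.take n))) ((residueField 𝒜).shift μ) i,
        e = 0) ∧
    Nontrivial
      (Abelian.Ext (baseQuot 𝒜 (Ideal.ofList (rs.take n))) ((residueField 𝒜).shift 0) n) := by
  induction n with
  | zero =>
    rw [List.take_zero, Ideal.ofList_nil]
    refine ⟨fun i μ hi e ↦ ?_, nontrivial_ext_zero_baseQuot hR⟩
    exact ext_eq_zero_of_hasFreeComponents hR h
      (fun j hj ↦ piece_baseQuot_of_ne (maximalIdeal R₀) hj) (hasFreeComponents_baseQuot_bot hR)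
      (a := 0) (fun j hj ↦ piece_baseQuot_of_ne _ hj.ne) (by push_cast at hi; omega) e
  | succ n ih =>
    obtain ⟨ih1, ih2⟩ := ih (by omega)
    have hJ' : Ideal.ofList (rs.take (n + 1)) =
        Ideal.ofList (rs.take n) ⊔ Ideal.span {rs[n]} := by
      rw [List.take_add_one, List.getElem?_eq_getElem hn, Option.toList_some, Ideal.ofList_append,
        Ideal.ofList_singleton]
    have hx (y : R₀) (hy : rs[n] * y ∈ Ideal.ofList (rs.take n)) :
        y ∈ Ideal.ofList (rs.take n) := by
      have := (isWeaklyRegular_iff R₀ rs).1 hreg n hn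
      rw [isSMulRegular_quotient_iff_mem_of_smul_mem, smul_eq_mul, Ideal.mul_top] at this
      exact this y hy
    obtain ⟨_, hS⟩ := shortExact_baseQuot hR hJ' (hJ' ▸ le_sup_left) hx
    refine ⟨fun i μ hi e ↦ ?_, ?_⟩
    · refine ext_eq_zero_of_shortExact hS (ih1 i μ (by push_cast at hi; omega))
        (fun l hl ↦ ih1 l μ ?_) e
      push_cast [← hl] at hi
      omega
    · exact nontrivial_ext_of_shortExact_smul hS
        (smul_id_shift_residueField_eq_zero (hrs _ (List.getElem_mem _)) 0) ih2

lemma irr_smul_residueField (a : R) (ha : a ∈ irr 𝒜) (x : (residueField 𝒜).carrier) :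
    a • x = 0 := by
  obtain ⟨b, rfl⟩ := Submodule.Quotient.mk_surjective _ x
  exact (Submodule.Quotient.mk_eq_zero _).2 (Ideal.mem_sup_right (Ideal.mul_mem_right _ _ ha))

/-- The regularity of the residue field of `R`, when the maximal ideal of `R₀` is generated by an
`R₀`-regular sequence of length `d` and the components of `R` are free. -/
lemma reg_residueField [IsNoetherianRing R₀] (hR : IsStandardGraded 𝒜)
    (h : ∀ n, Module.Free R₀ (𝒜 n) ∧ Module.Finite R₀ (𝒜 n)) {rs : List R₀}
    (hrs : Ideal.ofList rs = maximalIdeal R₀) (hreg : IsWeaklyRegular R₀ rs) :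
    reg (residueField 𝒜) (residueField 𝒜) = rs.length := by
  obtain ⟨h1, h2⟩ := ext_baseQuot_take hR h (fun r hr ↦ hrs ▸ Ideal.subset_span hr) hreg le_rfl
  rw [List.take_length, hrs, baseQuot_maximalIdeal] at h1 h2
  apply le_antisymm
  · refine iSup_le fun i ↦ ?_
    -- The bound on `aInvariant` is a real number, so that `EReal` subtraction is avoided.
    have : aInvariant (residueField 𝒜) (residueField 𝒜) i ≤ ((rs.length - i : ℝ) : EReal) := by
      refine iSup₂_le fun μ hμ ↦ ?_
      rw [nontrivial_genLocalCohomology_iff irr_smul_residueField] at hμ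
      obtain ⟨e, he⟩ := exists_ne
        (0 : Abelian.Ext (residueField 𝒜) ((residueField 𝒜).shift μ) i)
      have : (i : ℤ) + μ ≤ rs.length := by
        by_contra! hlt
        exact he (h1 i μ hlt e)
      rw [EReal.coe_le_coe_iff, le_sub_iff_add_le, add_comm]
      exact_mod_cast this
    refine (add_le_add_left this _).trans ?_
    rw [← EReal.coe_natCast (n := i), ← EReal.coe_add, sub_add_cancel, EReal.coe_natCast]
  · refine le_trans ?_ (le_iSup _ rs.length)
    have : (0 : EReal) ≤ aInvariant (residueField 𝒜) (residueField 𝒜) rs.length := by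
      rw [← nontrivial_genLocalCohomology_iff irr_smul_residueField] at h2
      refine le_trans ?_ (le_iSup₂ (0 : ℤ) h2)
      simp
    simpa using add_le_add_left this (rs.length : EReal)

end Vanishing

end GrMod

theorem mainTheorem9 {R₀ R : Type u} [CommRing R₀] [CommRing R] [Algebra R₀ R]
    [IsRegularLocalRing R₀] [IsNoetherianRing R]
    (𝒜 : ℕ → Submodule R₀ R) [GradedAlgebra 𝒜] (hR : IsStandardGraded 𝒜)
    (d : ℕ) (hd : ringKrullDim R₀ = d) :
    ((∃ rs : List R₀, rs.length = d ∧ (∀ r ∈ rs, r ∈ IsLocalRing.maximalIdeal R₀) ∧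
        RingTheory.Sequence.IsRegular R rs) ↔ ∀ μ : ℕ, Module.Free R₀ (𝒜 μ)) ∧
    ((∃ rs : List R₀, rs.length = d ∧ (∀ r ∈ rs, r ∈ IsLocalRing.maximalIdeal R₀) ∧
        RingTheory.Sequence.IsRegular R rs) →
      GrMod.reg (GrMod.residueField 𝒜) (GrMod.residueField 𝒜) = d) := by
  refine ⟨exists_isRegular_iff_free_component hR hd, fun h ↦ ?_⟩
  rw [exists_isRegular_iff_free_component hR hd] at h
  obtain ⟨rs, rfl, hspan, hreg⟩ := exists_isWeaklyRegular_ofList_eq_maximalIdeal hd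
  refine GrMod.reg_residueField hR (fun n ↦ ⟨h n, ?_⟩) hspan hreg
  have := hR.isNoetherian_component n
  infer_instance
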